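/- Let $0<p<1$, $q=1-p$, $N\in\mathbb{Z}_{\ge 0}$ and $x\in\mathbb{Z}$. A configuration $\mathcal{T}$ is a family of integers $\tau^n_i\ge x$ $(1\le i\le n\le N)$ with $\tau^n_n<\tau^n_{n-1}<\dots<\tau^n_1$ for every $n$; it is identified with the set of points $\{(n,\tau^n_i):1\le i\le n\le N\}\subset\{1,\dots,N\}\times\mathbb{Z}_{\ge x}$. Put $\phi_n(z,y)=p$ if $y\ge z$ and $\phi_n(z,y)=0$ if $y<z$, with the convention $\phi_n(\tau^n_{n+1},y)=p$ for the fictitious variables $\tau^n_{n+1}$. For $t\in\mathbb{Z}$ and $0\le k\le N-1$ put $$\widetilde F_n(y,t)=\frac{1}{2\pi i}\oint_{\Gamma_0}\frac{dw}{w}\Big(q+\frac pw\Big)^t(1-w)^{-n}w^{y},\qquad \Psi^N_k(t)=(-1)^k\widetilde F_{-k}(x+N-k-1,t),$$ where $\Gamma_0$ is a small circle around $0$, with $1$ and $-p/q$ outside, and let $$W(\mathcal{T})=\prod_{n=0}^{N-1}\det\big[\phi_n(\tau^n_i,\tau^{n+1}_j)\big]_{i,j=1}^{n+1}\;\det\big[\Psi^N_i(\tau^N_{N-j})\big]_{i,j=0}^{N-1}.$$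 Then $\sum_{\mathcal T}W(\mathcal T)$ converges absolutely to some $Z_N\ne 0$, and there is a (real) signed measure $\mathcal M$ on the set of configurations with $\mathcal M(\{\mathcal T\})=Z_N^{-1}W(\mathcal T)$ for every $\mathcal T$. This measure is determinantal: for all $m\ge 0$ and all pairwise distinct points $(n_1,\tau_1),\dots,(n_m,\tau_m)$ of $\{1,\dots,N\}\times\mathbb{Z}_{\ge x}$, $$\mathcal M\big(\{\mathcal T:(n_1,\tau_1),\dots,(n_m,\tau_m)\in\mathcal T\}\big)=\det\big[K(n_i,\tau_i;n_j,\tau_j)\big]_{i,j=1}^m,$$ where $$K(n_1,\tau_1;n_2,\tau_2)=p\oint_{\Gamma_1}\frac{dv}{2\pi i v}\oint_{\Gamma_{0,v}}\frac{dw}{2\pi i w}\,\frac{\big(1-p\frac{w-1}{w}\big)^{\tau_1}\big(\frac{w-1}{w}\big)^{n_1}(w/v)^{x+N}}{\big(1-p\frac{v-1}{v}\big)^{\tau_2+1}\big(\frac{v-1}{v}\big)^{n_2}(w-v)}$$ $$\qquad-\mathbf 1(n_2>n_1)\oint_{\Gamma_{1,0}}\frac{p\,dz}{2\pi i z^2}\Big(\frac{z-1}{z}\Big)^{n_1-n_2}\Big(1-p\frac{z-1}{z}\Big)^{\tau_1-\tau_2-1}.$$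 Here the contours are any anticlockwise circles such that: $\Gamma_1$ encircles $1$ and leaves $0$ and $-p/q$ outside; $\Gamma_{0,v}$ encircles $0$ and the whole of $\Gamma_1$ and leaves $-p/q$ outside; $\Gamma_{1,0}$ encircles $0$ and $1$ and leaves $-p/q$ outside. -/

import Mathlib

namespace TasepKernel

noncomputable section

open Complex

/-- The factor `1 - p (w - 1) / w = q + p / w`, where `q = 1 - p`. -/
def symb (p : ℝ) (w : ℂ) : ℂ := 1 - p * ((w - 1) / w)

/-- The function `F̃_n(x, t) = (2πi)⁻¹ ∮ dw/w (q + p/w)^t (1 - w)^(-n) w^x`, defined for all `t ∈ ℤ`.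
The contour encircles the pole `w = 0` and leaves the other possible singularities `w = 1` and
`w = -p/q` outside; for `0 < p < 1` the circle `|w| = p/2` is such a contour. -/
def Ftilde (p : ℝ) (n x t : ℤ) : ℂ :=
  (2 * Real.pi * I)⁻¹ *
    ∮ w in C(0, p / 2), w⁻¹ * ((1 - p : ℂ) + p / w) ^ t * (1 - w) ^ (-n) * w ^ x

/-- The functions `Ψ^N_k(t) = (-1)^k F̃_{-k}(x + N - k - 1, t)`. -/
def Psi (p : ℝ) (N : ℕ) (x : ℤ) (k : ℕ) (t : ℤ) : ℂ :=
  (-1) ^ k * Ftilde p (-(k : ℤ)) (x + N - k - 1) t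

/-- The transition function `φ_n(z, y) = p 1(y ≥ z)` (it does not depend on `n`). -/
def phi (p : ℝ) (z y : ℤ) : ℝ := if z ≤ y then p else 0

/-- A configuration `𝒯`: integers `τ^n_i` (written `T n i`), `1 ≤ i ≤ n ≤ N`, in `ℤ_{≥ x}` with
`τ^n_n < τ^n_{n-1} < ⋯ < τ^n_1` for every `n`. Entries outside this index range are set to `0`. -/
structure Config (N : ℕ) (x : ℤ) where
  /-- the entries `τ^n_i` -/
  entry : ℕ → ℕ → ℤ
  lower : ∀ n i, 1 ≤ i → i ≤ n → n ≤ N → x ≤ entry n i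
  strict : ∀ n i j, 1 ≤ i → i < j → j ≤ n → n ≤ N → entry n j < entry n i
  outside : ∀ n i, ¬ (1 ≤ i ∧ i ≤ n ∧ n ≤ N) → entry n i = 0

instance (N : ℕ) (x : ℤ) : CoeFun (Config N x) (fun _ => ℕ → ℕ → ℤ) := ⟨Config.entry⟩

/-- The (countable) space of configurations is discrete: all its subsets are measurable. -/
instance (N : ℕ) (x : ℤ) : MeasurableSpace (Config N x) := ⊤

/-- The finite subset `{(n, τ^n_i) : 1 ≤ i ≤ n ≤ N}` of `{1, …, N} × ℤ_{≥ x}`. -/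
def Config.points {N : ℕ} {x : ℤ} (T : Config N x) : Set (ℕ × ℤ) :=
  {a | a.1 ≤ N ∧ ∃ i, 1 ≤ i ∧ i ≤ a.1 ∧ T a.1 i = a.2}

/-- The matrix `[φ_n(τ^n_i, τ^{n+1}_j)]`, `1 ≤ i, j ≤ n + 1`; its last row `i = n + 1` belongs to the
fictitious variable `τ^n_{n+1}`, for which `φ_n(τ^n_{n+1}, y) = p`. -/
def phiMatrix (p : ℝ) {N : ℕ} {x : ℤ} (T : Config N x) (n : ℕ) :
    Matrix (Fin (n + 1)) (Fin (n + 1)) ℝ :=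
  Matrix.of fun i j => if (i : ℕ) < n then phi p (T n (i + 1)) (T (n + 1) (j + 1)) else p

/-- The matrix `[Ψ^N_i(τ^N_{N-j})]`, `0 ≤ i, j ≤ N - 1`. -/
def PsiMatrix (p : ℝ) {N : ℕ} {x : ℤ} (T : Config N x) : Matrix (Fin N) (Fin N) ℂ :=
  Matrix.of fun i j => Psi p N x i (T N (N - j))

/-- The unnormalized weight of a configuration. -/
def weight (p : ℝ) {N : ℕ} {x : ℤ} (T : Config N x) : ℂ :=
  ((∏ n ∈ Finset.range N, (phiMatrix p T n).det : ℝ) : ℂ) * (PsiMatrix p T).det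

/-- The normalization constant `Z_N`: the sum of all weights. -/
def partitionFunction (p : ℝ) (N : ℕ) (x : ℤ) : ℂ := ∑' T : Config N x, weight p T

/-- `K` is a correlation kernel of the signed measure `M`: for pairwise distinct points
`a_1, …, a_m` of `{1, …, N} × ℤ_{≥ x}` the `m`-point correlation function
`M {T : a_1, …, a_m ∈ T}` is `det [K(a_i, a_j)]`. -/
def IsCorrelationKernel {N : ℕ} {x : ℤ} (M : MeasureTheory.SignedMeasure (Config N x))
    (K : ℕ × ℤ → ℕ × ℤ → ℂ) : Prop :=
  ∀ (m : ℕ) (a : Fin m → ℕ × ℤ), Function.Injective a →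
    (∀ i, 1 ≤ (a i).1 ∧ (a i).1 ≤ N ∧ x ≤ (a i).2) →
    ((M {T | ∀ i, a i ∈ T.points} : ℝ) : ℂ) = (Matrix.of fun i j => K (a i) (a j)).det

/-- The double contour integral, with `v` on the circle `C(c₁, r₁)` and `w` on `C(c₀, r₀)`. -/
def doubleIntegral (p : ℝ) (N : ℕ) (x : ℤ) (c₁ : ℂ) (r₁ : ℝ) (c₀ : ℂ) (r₀ : ℝ)
    (n₁ : ℕ) (τ₁ : ℤ) (n₂ : ℕ) (τ₂ : ℤ) : ℂ :=
  p * ∮ v in C(c₁, r₁), (2 * Real.pi * I * v)⁻¹ *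
    ∮ w in C(c₀, r₀), (2 * Real.pi * I * w)⁻¹ *
      (symb p w ^ τ₁ * ((w - 1) / w) ^ n₁ * (w / v) ^ (x + N) /
        (symb p v ^ (τ₂ + 1) * ((v - 1) / v) ^ n₂ * (w - v)))

/-- The single contour integral, with `z` on the circle `C(c, r)`. -/
def singleIntegral (p : ℝ) (c : ℂ) (r : ℝ) (n₁ : ℕ) (τ₁ : ℤ) (n₂ : ℕ) (τ₂ : ℤ) : ℂ :=
  ∮ z in C(c, r), p / (2 * Real.pi * I * z ^ 2) *
    ((z - 1) / z) ^ ((n₁ : ℤ) - (n₂ : ℤ)) * symb p z ^ (τ₁ - τ₂ - 1)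

/-- The kernel `K(n₁, τ₁; n₂, τ₂)`. -/
def kernel (p : ℝ) (N : ℕ) (x : ℤ) (c₁ : ℂ) (r₁ : ℝ) (c₀ : ℂ) (r₀ : ℝ) (c : ℂ) (r : ℝ)
    (a b : ℕ × ℤ) : ℂ :=
  doubleIntegral p N x c₁ r₁ c₀ r₀ a.1 a.2 b.1 b.2 -
    if a.1 < b.1 then singleIntegral p c r a.1 a.2 b.1 b.2 else 0

end

end TasepKernel

/-
Summing the product of the determinants over the configurations level by level, by Cauchy–Binet for
strictly decreasing tuples, gives a single determinant. Its entries are obtained from the functions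
`Ψ^N_j` by repeated summation against `φ`, and the row of a fictitious variable is the summation
started from the lowest position `x`. The functions `Ψ^n_j` are contour integrals which `φ`
transforms into one another, `φ * Ψ^n_j = Ψ^{n-1}_{j-1}`; they decay geometrically, so that the
truncation to positions below `L` disappears as `L → ∞`. For `m = 0` the limiting matrix
`[Ψ^i_j(x)]` is unitriangular, whence `Z_N = 1`.

To mark the points `a_1, …, a_m`, give every configuration the additional factor `1 + g` for each
marked point it contains. Splitting every summation at its last passage through a marked point
expresses the resulting determinant by `[Ψ^i_j(x)]`, the functions `Ψ^n_j` at the marked points and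
the transition functions between them. Expanding `(w - v)⁻¹` in the double contour integral into a
geometric sum writes it as a sum over `j` of `Ψ^{n₁}_j(τ₁)` times a dual function, and on the floor
`(n₁, τ₁) = (i, x)` it equals the transition function. The matrix determinant lemma then turns the
generating function into `det (1 + g K)`, whose coefficient at `g^m` is the correlation function.
-/

namespace TasepKernel

section CircleIntegrals

open Complex Metric

variable {U : Set ℂ} {a b c c' : ℂ} {r r' : ℝ} {f : ℂ → ℂ}

theorem ne_of_mem_sphere_of_mem_ball {z : ℂ} (hz : z ∈ sphere c r) (ha : a ∈ ball c r) : z ≠ a :=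
  ne_of_mem_of_not_mem hz fun h => (mem_ball.1 ha).ne (mem_sphere.1 h)

theorem continuousOn_sub_zpow (ha : a ∈ ball c r) (e : ℤ) :
    ContinuousOn (fun w => (w - a) ^ e) (sphere c r) :=
  ContinuousOn.zpow₀ (by fun_prop) e fun _ hz =>
    Or.inl (sub_ne_zero.2 (ne_of_mem_sphere_of_mem_ball hz ha))

theorem circleIntegral_eq_zero_of_differentiableOn (hr : 0 ≤ r)
    (hf : DifferentiableOn ℂ f (closedBall c r)) : ∮ w in C(c, r), f w = 0 :=
  (hf.mono closure_ball_subset_closedBall).diffContOnCl.circleIntegral_eq_zero hr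

theorem circleIntegral_sub_zpow (ha : a ∈ ball c r) (e : ℤ) :
    ∮ w in C(c, r), (w - a) ^ e = if e = -1 then 2 * Real.pi * I else 0 := by
  split_ifs with he
  · simpa [he] using circleIntegral.integral_sub_inv_of_mem_ball ha
  · exact circleIntegral.integral_sub_zpow_of_ne he c a r

theorem circleIntegral_zpow_mul_eq_add_dslope (hU : IsOpen U) (hc : closedBall c r ⊆ U)
    (ha : a ∈ ball c r) (e : ℤ) (hf : DifferentiableOn ℂ f U) :
    ∮ w in C(c, r), (w - a) ^ e * f w =
      f a * (if e = -1 then 2 * Real.pi * I else 0) +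
        ∮ w in C(c, r), (w - a) ^ (e + 1) * dslope f a w := by
  have hr : 0 ≤ r := (pos_of_mem_ball ha).le
  have hd : ContinuousOn (dslope f a) (sphere c r) :=
    ((differentiableOn_dslope (hU.mem_nhds (hc (ball_subset_closedBall ha)))).2
      hf).continuousOn.mono (sphere_subset_closedBall.trans hc)
  rw [← circleIntegral_sub_zpow ha, ← circleIntegral.integral_const_mul,
    ← circleIntegral.integral_add]
  rotate_left
  · exact (continuousOn_const.mul (continuousOn_sub_zpow ha e)).circleIntegrable hr
  · exact ((continuousOn_sub_zpow ha (e + 1)).mul hd).circleIntegrable hr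
  refine circleIntegral.integral_congr hr fun z hz => ?_
  have hs : (z - a) * dslope f a z = f z - f a := by simpa using sub_smul_dslope f a z
  simp only [zpow_add_one₀ (sub_ne_zero.2 (ne_of_mem_sphere_of_mem_ball hz ha))]
  linear_combination -(z - a) ^ e * hs

theorem differentiable_sub_zpow (a : ℂ) {e : ℤ} (he : 0 ≤ e) :
    Differentiable ℂ fun w => (w - a) ^ e := by
  lift e to ℕ using he
  simp only [zpow_natCast]
  fun_prop

/-- Splitting off the value `f a` with `dslope` lowers the order of the pole at `a` by one. -/
theorem circleIntegral_zpow_mul_eq (hU : IsOpen U) (hc : closedBall c r ⊆ U)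
    (hc' : closedBall c' r' ⊆ U) (ha : a ∈ ball c r) (ha' : a ∈ ball c' r') (e : ℤ)
    (hf : DifferentiableOn ℂ f U) :
    ∮ w in C(c, r), (w - a) ^ e * f w = ∮ w in C(c', r'), (w - a) ^ e * f w := by
  obtain ⟨m, hm⟩ : ∃ m : ℕ, -e ≤ m := ⟨(-e).toNat, Int.self_le_toNat _⟩
  induction m generalizing e f with
  | zero =>
    have hd : DifferentiableOn ℂ (fun w => (w - a) ^ e * f w) U :=
      (differentiable_sub_zpow a (by omega)).differentiableOn.mul hf
    rw [circleIntegral_eq_zero_of_differentiableOn (pos_of_mem_ball ha).le (hd.mono hc),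
      circleIntegral_eq_zero_of_differentiableOn (pos_of_mem_ball ha').le (hd.mono hc')]
  | succ m ih =>
    rw [circleIntegral_zpow_mul_eq_add_dslope hU hc ha e hf,
      circleIntegral_zpow_mul_eq_add_dslope hU hc' ha' e hf, ih (e + 1)
        ((differentiableOn_dslope (hU.mem_nhds (hc (ball_subset_closedBall ha)))).2 hf) (by omega)]

theorem circleIntegral_zpow_mul_zpow_mul_eq_sub (hc : ContinuousOn f (sphere c r))
    (hab : a ≠ b) (ha : a ∈ ball c r) (hb : b ∈ ball c r) (e l : ℤ) :
    ∮ w in C(c, r), (w - a) ^ e * ((w - b) ^ l * f w) =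
      (a - b)⁻¹ * ((∮ w in C(c, r), (w - a) ^ e * ((w - b) ^ (l + 1) * f w)) -
        ∮ w in C(c, r), (w - a) ^ (e + 1) * ((w - b) ^ l * f w)) := by
  have hr : 0 ≤ r := (pos_of_mem_ball ha).le
  have hi : ∀ i j : ℤ, CircleIntegrable (fun w => (w - a) ^ i * ((w - b) ^ j * f w)) c r :=
    fun i j => ((continuousOn_sub_zpow ha i).mul
      ((continuousOn_sub_zpow hb j).mul hc)).circleIntegrable hr
  rw [← circleIntegral.integral_sub (hi _ _) (hi _ _), ← circleIntegral.integral_const_mul]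
  refine circleIntegral.integral_congr hr fun z hz => ?_
  simp only [zpow_add_one₀ (sub_ne_zero.2 (ne_of_mem_sphere_of_mem_ball hz ha)),
    zpow_add_one₀ (sub_ne_zero.2 (ne_of_mem_sphere_of_mem_ball hz hb))]
  field_simp [sub_ne_zero.2 hab]
  ring

/-- Partial fractions reduce two poles to one. -/
theorem circleIntegral_zpow_mul_zpow_mul_eq (hU : IsOpen U) (hc : closedBall c r ⊆ U)
    (hc' : closedBall c' r' ⊆ U) (hab : a ≠ b) (ha : a ∈ ball c r) (ha' : a ∈ ball c' r')
    (hb : b ∈ ball c r) (hb' : b ∈ ball c' r') (e l : ℤ) (hf : DifferentiableOn ℂ f U) :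
    ∮ w in C(c, r), (w - a) ^ e * ((w - b) ^ l * f w) =
      ∮ w in C(c', r'), (w - a) ^ e * ((w - b) ^ l * f w) := by
  obtain ⟨k, hk⟩ : ∃ k : ℕ, -e - l ≤ k := ⟨(-e - l).toNat, Int.self_le_toNat _⟩
  induction k generalizing e l with
  | zero =>
    rcases le_or_gt 0 l with hl | hl
    · exact circleIntegral_zpow_mul_eq hU hc hc' ha ha' e
        ((differentiable_sub_zpow b hl).differentiableOn.mul hf)
    · simp only [mul_left_comm _ ((_ - b) ^ l)]
      exact circleIntegral_zpow_mul_eq hU hc hc' hb hb' l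
        ((differentiable_sub_zpow a (by omega)).differentiableOn.mul hf)
  | succ k ih =>
    have hcont : ∀ {c r}, closedBall c r ⊆ U → ContinuousOn f (sphere c r) := fun h =>
      hf.continuousOn.mono (sphere_subset_closedBall.trans h)
    rw [circleIntegral_zpow_mul_zpow_mul_eq_sub (hcont hc) hab ha hb,
      circleIntegral_zpow_mul_zpow_mul_eq_sub (hcont hc') hab ha' hb',
      ih e (l + 1) (by omega), ih (e + 1) l (by omega)]

open scoped ComplexConjugate

theorem conj_circleMap (c : ℂ) (r θ : ℝ) :
    conj (circleMap c r θ) = circleMap (conj c) r (2 * Real.pi - θ) := by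
  rw [sub_eq_neg_add, periodic_circleMap (conj c) r (-θ)]
  simp [circleMap, ← exp_conj]

theorem conj_circleIntegral (f : ℂ → ℂ) (c : ℂ) (r : ℝ) :
    conj (∮ w in C(c, r), f w) = -∮ w in C(conj c, r), conj (f (conj w)) := by
  have hsub := intervalIntegral.integral_comp_sub_left (a := 0) (b := 2 * Real.pi)
    (fun θ => deriv (circleMap (conj c) r) θ • conj (f (conj (circleMap (conj c) r θ))))
    (2 * Real.pi)
  simp only [sub_self, sub_zero] at hsub
  rw [circleIntegral, circleIntegral, ← intervalIntegral.intervalIntegral_conj, ← hsub,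
    ← intervalIntegral.integral_neg]
  refine intervalIntegral.integral_congr fun θ _ => ?_
  have h0 := conj_circleMap 0 r θ
  rw [map_zero] at h0
  simp only [deriv_circleMap, smul_eq_mul, map_mul, conj_I, h0, ← conj_circleMap, conj_conj]
  ring

end CircleIntegrals

section SymbMonomial

open Complex Metric

variable {p : ℝ} {c c' w : ℂ} {r r' : ℝ}

/-- The numerator `q w + p` of the factor `q + p / w`, where `q = 1 - p`. -/
def symbNum (p : ℝ) (w : ℂ) : ℂ := (1 - p) * w + p

/-- The integrands of the paper, written as products of powers of `q w + p`, `w - 1` and `w`. -/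
noncomputable def symbMonomial (p : ℝ) (t e k : ℤ) (w : ℂ) : ℂ :=
  symbNum p w ^ t * (w - 1) ^ e * w ^ k

/-- The contour integral `(2πi)⁻¹ ∮ (q w + p)^t (w - 1)^e w^k dw`. -/
noncomputable def symbIntegral (p : ℝ) (c : ℂ) (r : ℝ) (t e k : ℤ) : ℂ :=
  (2 * Real.pi * I)⁻¹ * ∮ w in C(c, r), symbMonomial p t e k w

/-- A circle that encircles `1` and leaves the zero `-p/q` of `q w + p` outside. -/
structure IsContour (p : ℝ) (c : ℂ) (r : ℝ) : Prop where
  one_mem : 1 ∈ ball c r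
  symbNum_ne_zero : ∀ w ∈ closedBall c r, symbNum p w ≠ 0

/-- A contour that encircles both `0` and `1`. -/
structure IsOuterContour (p : ℝ) (c : ℂ) (r : ℝ) : Prop extends IsContour p c r where
  zero_mem : 0 ∈ ball c r

/-- A contour that encircles `1` and leaves `0` outside. -/
structure IsInnerContour (p : ℝ) (c : ℂ) (r : ℝ) : Prop extends IsContour p c r where
  zero_notMem : 0 ∉ closedBall c r

theorem symb_eq_div (hw : w ≠ 0) : symb p w = symbNum p w / w := by
  unfold symb symbNum
  field_simp
  ring

theorem symb_zpow_mul (hw : w ≠ 0) (t e k : ℤ) :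
    symb p w ^ t * ((w - 1) / w) ^ e * w ^ k = symbMonomial p t e (k - t - e) w := by
  rw [symb_eq_div hw, div_zpow, div_zpow, symbMonomial, zpow_sub₀ hw, zpow_sub₀ hw]
  ring

@[simp]
theorem symbNum_one (p : ℝ) : symbNum p 1 = 1 := by simp [symbNum]

theorem differentiable_symbNum (p : ℝ) : Differentiable ℂ (symbNum p) := by
  unfold symbNum
  fun_prop

theorem symbNum_ne_zero_of_ne (hp : p < 1) (hw : w ≠ (-(p / (1 - p)) : ℂ)) : symbNum p w ≠ 0 := by
  have hq : (1 - p : ℂ) ≠ 0 := sub_ne_zero.2 (by exact_mod_cast hp.ne')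
  refine fun h => hw ?_
  unfold symbNum at h
  field_simp
  linear_combination h

theorem IsContour.of_notMem (hp : p < 1) (h1 : 1 ∈ ball c r)
    (hq : (-(p / (1 - p)) : ℂ) ∉ closedBall c r) : IsContour p c r :=
  ⟨h1, fun _ hw => symbNum_ne_zero_of_ne hp (ne_of_mem_of_not_mem hw hq)⟩

theorem IsContour.nonneg (h : IsContour p c r) : 0 ≤ r := (pos_of_mem_ball h.one_mem).le

theorem IsContour.sub_one_ne_zero (h : IsContour p c r) (hw : w ∈ sphere c r) : w - 1 ≠ 0 :=
  sub_ne_zero.2 (ne_of_mem_sphere_of_mem_ball hw h.one_mem)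

theorem IsContour.symbNum_ne_zero_of_mem_sphere (h : IsContour p c r) (hw : w ∈ sphere c r) :
    symbNum p w ≠ 0 :=
  h.symbNum_ne_zero w (sphere_subset_closedBall hw)

theorem IsOuterContour.ne_zero (h : IsOuterContour p c r) (hw : w ∈ sphere c r) : w ≠ 0 :=
  ne_of_mem_sphere_of_mem_ball hw h.zero_mem

theorem IsInnerContour.ne_zero (h : IsInnerContour p c r) (hw : w ∈ closedBall c r) : w ≠ 0 :=
  ne_of_mem_of_not_mem hw h.zero_notMem

theorem IsContour.continuousOn_symbMonomial (h : IsContour p c r)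
    (h0 : ∀ w ∈ sphere c r, w ≠ 0) (t e k : ℤ) :
    ContinuousOn (symbMonomial p t e k) (sphere c r) :=
  (((differentiable_symbNum p).continuous.continuousOn.zpow₀ t fun _ hw =>
    Or.inl (h.symbNum_ne_zero_of_mem_sphere hw)).mul (continuousOn_sub_zpow h.one_mem e)).mul
    (continuousOn_id.zpow₀ k fun w hw => Or.inl (h0 w hw))

theorem IsContour.circleIntegrable_symbMonomial (h : IsContour p c r)
    (h0 : ∀ w ∈ sphere c r, w ≠ 0) (t e k : ℤ) : CircleIntegrable (symbMonomial p t e k) c r :=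
  (h.continuousOn_symbMonomial h0 t e k).circleIntegrable h.nonneg

/-- Integrated form of `w - (q w + p) = p (w - 1)`. -/
theorem IsOuterContour.symbIntegral_sub (h : IsOuterContour p c r) (t e k : ℤ) :
    symbIntegral p c r t e (k + 1) - symbIntegral p c r (t + 1) e k =
      p * symbIntegral p c r t (e + 1) k := by
  have hi := h.circleIntegrable_symbMonomial fun _ => h.ne_zero
  simp only [symbIntegral]
  rw [← mul_sub, ← circleIntegral.integral_sub (hi _ _ _) (hi _ _ _), mul_left_comm,
    ← circleIntegral.integral_const_mul (p : ℂ)]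
  refine congrArg _ (circleIntegral.integral_congr h.nonneg fun w hw => ?_)
  simp only [symbMonomial, zpow_add_one₀ (h.ne_zero hw), zpow_add_one₀ (h.sub_one_ne_zero hw),
    zpow_add_one₀ (h.symbNum_ne_zero_of_mem_sphere hw)]
  unfold symbNum
  ring

end SymbMonomial

section Residues

open Complex Metric

variable {p : ℝ} {c c' : ℂ} {r r' : ℝ} {t e k : ℤ}

theorem differentiableOn_symbNum_zpow_mul_zpow {s : Set ℂ} (hq : ∀ w ∈ s, symbNum p w ≠ 0)
    (hk : 0 ∉ s ∨ 0 ≤ k) : DifferentiableOn ℂ (fun w => symbNum p w ^ t * w ^ k) s :=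
  ((differentiable_symbNum p).differentiableOn.zpow (Or.inl hq)).mul
    (differentiableOn_id.zpow (hk.imp_left fun h0 _ hw => ne_of_mem_of_not_mem hw h0))

theorem symbMonomial_eq (p : ℝ) (t e k : ℤ) (w : ℂ) :
    symbMonomial p t e k w = (w - 1) ^ e * (symbNum p w ^ t * w ^ k) := by
  rw [symbMonomial]
  ring

theorem differentiableOn_symbMonomial {s : Set ℂ} (hq : ∀ w ∈ s, symbNum p w ≠ 0) (he : 0 ≤ e)
    (hk : 0 ∉ s ∨ 0 ≤ k) : DifferentiableOn ℂ (symbMonomial p t e k) s :=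
  ((differentiable_sub_zpow 1 he).differentiableOn.mul
    (differentiableOn_symbNum_zpow_mul_zpow hq hk)).congr fun w _ => symbMonomial_eq p t e k w

theorem IsContour.symbIntegral_eq_zero (h : IsContour p c r) (he : 0 ≤ e)
    (hk : 0 ∉ closedBall c r ∨ 0 ≤ k) : symbIntegral p c r t e k = 0 := by
  rw [symbIntegral, circleIntegral_eq_zero_of_differentiableOn h.nonneg
    (differentiableOn_symbMonomial h.symbNum_ne_zero he hk), mul_zero]

theorem IsContour.symbIntegral_neg_one (h : IsContour p c r)
    (hk : 0 ∉ closedBall c r ∨ 0 ≤ k) : symbIntegral p c r t (-1) k = 1 := by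
  have hres := (differentiableOn_symbNum_zpow_mul_zpow (t := t) h.symbNum_ne_zero
    hk).circleIntegral_sub_inv_smul h.one_mem
  simp only [smul_eq_mul, symbNum_one, one_zpow, mul_one] at hres
  simp only [symbIntegral, symbMonomial_eq, zpow_neg_one, hres]
  exact inv_mul_cancel₀ Complex.two_pi_I_ne_zero

theorem isOpen_symbNum_ne_zero (p : ℝ) : IsOpen {w | symbNum p w ≠ 0} :=
  isOpen_ne_fun (differentiable_symbNum p).continuous continuous_const

theorem IsContour.symbIntegral_eq (h : IsContour p c r) (h' : IsContour p c' r') (hk : 0 ≤ k) :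
    symbIntegral p c r t e k = symbIntegral p c' r' t e k := by
  simp only [symbIntegral, symbMonomial_eq]
  rw [circleIntegral_zpow_mul_eq (isOpen_symbNum_ne_zero p) h.symbNum_ne_zero h'.symbNum_ne_zero
    h.one_mem h'.one_mem e
    (differentiableOn_symbNum_zpow_mul_zpow (fun _ hw => hw) (Or.inr hk))]

end Residues

section Growth

open Complex Metric

variable {p : ℝ} {c w : ℂ} {r R : ℝ} {t e k : ℤ}

theorem norm_symbNum_le (hp0 : 0 ≤ p) (hp1 : p ≤ 1) (w : ℂ) :
    ‖symbNum p w‖ ≤ (1 - p) * ‖w‖ + p := by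
  refine (norm_add_le _ _).trans_eq ?_
  rw [norm_mul, show (1 - p : ℂ) = ((1 - p : ℝ) : ℂ) by push_cast; rfl, norm_real, norm_real,
    Real.norm_of_nonneg (by linarith), Real.norm_of_nonneg hp0]

theorem norm_sub_one_zpow_le (hw : 2 ≤ ‖w‖) (e : ℤ) :
    ‖(w - 1) ^ e‖ ≤ 2 ^ e.natAbs * ‖w‖ ^ e := by
  have hlow : ‖w‖ / 2 ≤ ‖w - 1‖ := by
    have := norm_sub_norm_le w 1
    rw [norm_one] at this
    linarith
  have hup : ‖w - 1‖ ≤ 2 * ‖w‖ := by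
    have := norm_sub_le w 1
    rw [norm_one] at this
    linarith
  rw [norm_zpow]
  obtain ⟨m, rfl | rfl⟩ := e.eq_nat_or_neg
  · rw [Int.natAbs_natCast, zpow_natCast, zpow_natCast, ← mul_pow]
    gcongr
  · rw [Int.natAbs_neg, Int.natAbs_natCast, zpow_neg, zpow_neg, zpow_natCast, zpow_natCast,
      ← inv_pow, ← inv_pow, ← mul_pow]
    gcongr
    rw [inv_le_comm₀ (by linarith) (by positivity), mul_inv, inv_inv]
    linarith

theorem norm_symbIntegral_le (hp0 : 0 ≤ p) (hp1 : p ≤ 1) (hR : 2 ≤ R) (ht : 0 ≤ t) (e k : ℤ) :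
    ‖symbIntegral p 0 R t e k‖ ≤ 2 ^ e.natAbs * ((1 - p) * R + p) ^ t * R ^ (e + k + 1) := by
  have hR0 : 0 < R := by linarith
  have hbound : ∀ w ∈ sphere (0 : ℂ) R, ‖symbMonomial p t e k w‖ ≤
      ((1 - p) * R + p) ^ t * (2 ^ e.natAbs * R ^ e) * R ^ k := by
    intro w hw
    obtain rfl : ‖w‖ = R := mem_sphere_zero_iff_norm.1 hw
    lift t to ℕ using ht
    rw [symbMonomial, norm_mul, norm_mul, norm_zpow w, zpow_natCast, zpow_natCast, norm_pow]
    gcongr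
    · exact norm_symbNum_le hp0 hp1 w
    · exact norm_sub_one_zpow_le hR e
  have h := circleIntegral.norm_two_pi_i_inv_smul_integral_le_of_norm_le_const hR0.le hbound
  rw [smul_eq_mul] at h
  refine h.trans_eq ?_
  rw [zpow_add₀ hR0.ne', zpow_add₀ hR0.ne', zpow_one]
  ring

theorem symbIntegral_eq_of_nonneg (h0 : 0 ∈ ball c r) (h1 : 1 ∈ ball c r) (hR : 1 < R)
    (ht : 0 ≤ t) (e k : ℤ) : symbIntegral p c r t e k = symbIntegral p 0 R t e k := by
  have hperm : ∀ w, symbMonomial p t e k w = (w - 1) ^ e * ((w - 0) ^ k * symbNum p w ^ t) :=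
    fun w => by rw [symbMonomial_eq, sub_zero, mul_comm (symbNum p w ^ t)]
  simp only [symbIntegral, hperm]
  rw [circleIntegral_zpow_mul_zpow_mul_eq isOpen_univ (Set.subset_univ _) (Set.subset_univ _)
    one_ne_zero h1 (by simpa) h0 (mem_ball_self (by linarith)) e k
    ((differentiable_symbNum p).differentiableOn.zpow (Or.inr ht))]

/-- The integrand decays faster than `|w|⁻¹`, so the contour can be moved to infinity. -/
theorem IsOuterContour.symbIntegral_eq_zero_of_add_lt (h : IsOuterContour p c r) (hp0 : 0 ≤ p)
    (hp1 : p ≤ 1) (ht : 0 ≤ t) (hdeg : t + e + k < -1) : symbIntegral p c r t e k = 0 := by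
  have hbound : ∀ R : ℝ, 2 ≤ R →
      ‖symbIntegral p c r t e k‖ ≤ 2 ^ e.natAbs * R ^ (t + e + k + 1) := by
    intro R hR
    rw [symbIntegral_eq_of_nonneg h.zero_mem h.one_mem (by linarith) ht]
    refine (norm_symbIntegral_le hp0 hp1 hR ht e k).trans ?_
    rw [show t + e + k + 1 = t + (e + k + 1) by ring, zpow_add₀ (by linarith) t, ← mul_assoc]
    lift t to ℕ using ht
    simp only [zpow_natCast]
    gcongr
    nlinarith
  have hlim : Filter.Tendsto (fun R : ℝ => 2 ^ e.natAbs * R ^ (t + e + k + 1)) Filter.atTop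
      (nhds (2 ^ e.natAbs * 0)) :=
    (tendsto_zpow_atTop_zero (by omega)).const_mul _
  rw [mul_zero] at hlim
  exact norm_le_zero_iff.1
    (ge_of_tendsto hlim ((Filter.eventually_ge_atTop 2).mono hbound))

theorem IsOuterContour.exists_norm_symbIntegral_le (h : IsOuterContour p c r) (hp0 : 0 ≤ p)
    (hp1 : p ≤ 1) (e k x : ℤ) :
    ∃ C : ℝ, 0 ≤ C ∧ ∀ t, x ≤ t → ‖symbIntegral p c r t e (k - t)‖ ≤ C * (1 - p / 2) ^ t := by
  have hρ : 0 < 1 - p / 2 := by linarith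
  have hsum : ∀ t, 0 ≤ ‖symbIntegral p c r t e (k - t)‖ / (1 - p / 2) ^ t := fun t => by
    positivity
  refine ⟨2 ^ e.natAbs * 2 ^ (e + k + 1) +
    ∑ t ∈ Finset.Ico x 0, ‖symbIntegral p c r t e (k - t)‖ / (1 - p / 2) ^ t,
    add_nonneg (by positivity) (Finset.sum_nonneg fun t _ => hsum t), fun t hxt => ?_⟩
  rw [← div_le_iff₀ (by positivity)]
  rcases le_or_gt 0 t with ht | ht
  · refine le_add_of_le_of_nonneg ?_ (Finset.sum_nonneg fun t _ => hsum t)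
    rw [div_le_iff₀ (by positivity),
      symbIntegral_eq_of_nonneg h.zero_mem h.one_mem one_lt_two ht]
    refine (norm_symbIntegral_le hp0 hp1 le_rfl ht e (k - t)).trans_eq ?_
    rw [show (1 - p) * 2 + p = (1 - p / 2) * 2 by ring, mul_zpow,
      show e + (k - t) + 1 = (e + k + 1) - t by ring, zpow_sub₀ two_ne_zero]
    field_simp
  · exact le_add_of_nonneg_of_le (by positivity)
      (Finset.single_le_sum (f := fun t => ‖symbIntegral p c r t e (k - t)‖ / (1 - p / 2) ^ t)
        (fun t _ => hsum t) (Finset.mem_Ico.2 ⟨hxt, ht⟩))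

end Growth

section Psi

open Complex Metric

variable {p : ℝ} {c : ℂ} {r : ℝ} {N : ℕ} {x : ℤ}

/-- The contour integral of the paper for `Ψ^N_e`, over a circle around both `0` and `1`; it makes
sense for every integer `e`. Descending `k` levels turns `Ψ^N_e` into `Ψ^N_{e-k}`. -/
noncomputable def psi (p : ℝ) (N : ℕ) (x : ℤ) (c : ℂ) (r : ℝ) (e t : ℤ) : ℂ :=
  symbIntegral p c r t e (x + N - 2 - e - t)

theorem symbNum_ne_zero_of_mem_closedBall_half (hp0 : 0 < p) (hp1 : p < 1) {w : ℂ}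
    (hw : w ∈ closedBall (0 : ℂ) (p / 2)) : symbNum p w ≠ 0 := by
  intro h
  have hnorm : ‖(1 - p : ℂ) * w‖ = p := by
    rw [eq_neg_of_add_eq_zero_left h, norm_neg, norm_real, Real.norm_of_nonneg hp0.le]
  rw [norm_mul, show (1 - p : ℂ) = ((1 - p : ℝ) : ℂ) by push_cast; rfl, norm_real,
    Real.norm_of_nonneg (by linarith)] at hnorm
  rw [mem_closedBall_zero_iff] at hw
  nlinarith

theorem Psi_eq_symbIntegral (hp0 : 0 < p) (N : ℕ) (x : ℤ) (k : ℕ) (t : ℤ) :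
    Psi p N x k t = symbIntegral p 0 (p / 2) t k (x + N - 2 - k - t) := by
  rw [Psi, Ftilde, symbIntegral, mul_left_comm, ← circleIntegral.integral_const_mul]
  refine congrArg _ (circleIntegral.integral_congr (by positivity) fun z hz => ?_)
  have hz0 : z ≠ 0 := ne_of_mem_sphere_of_mem_ball hz (mem_ball_self (by positivity))
  have hsymb : (1 - p : ℂ) + p / z = symbNum p z / z := by
    unfold symbNum
    field_simp
  have hsign : (1 - z) ^ k = (-1) ^ k * (z - 1) ^ k := by
    rw [← mul_pow]
    ring
  have hone : (-1 : ℂ) ^ k * (-1) ^ k = 1 := by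
    rw [← mul_pow]
    simp
  have hpow : z ^ (x + N - 2 - k - t) = z⁻¹ * z ^ (x + N - k - 1) / z ^ t := by
    rw [← zpow_neg_one, ← zpow_add₀ hz0, ← zpow_sub₀ hz0]
    congr 1
    ring
  simp only [symbMonomial, neg_neg, zpow_natCast, hsymb, hsign, hpow, div_zpow]
  linear_combination symbNum p z ^ t * (z - 1) ^ k * z⁻¹ * z ^ (x + N - k - 1) / z ^ t * hone

theorem IsOuterContour.Psi_eq_psi (h : IsOuterContour p c r) (hp0 : 0 < p) (hp1 : p < 1)
    (N : ℕ) (x : ℤ) (k : ℕ) (t : ℤ) : Psi p N x k t = psi p N x c r k t := by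
  have hperm : ∀ (k' : ℤ) (w : ℂ), symbMonomial p t k k' w =
      (w - 0) ^ k' * (symbNum p w ^ t * (w - 1) ^ (k : ℤ)) := fun _ _ => by
    rw [symbMonomial, sub_zero, mul_comm]
  rw [Psi_eq_symbIntegral hp0]
  simp only [psi, symbIntegral, hperm]
  rw [circleIntegral_zpow_mul_eq (isOpen_symbNum_ne_zero p)
    (fun _ => symbNum_ne_zero_of_mem_closedBall_half hp0 hp1) h.symbNum_ne_zero
    (mem_ball_self (by positivity)) h.zero_mem]
  exact ((differentiable_symbNum p).differentiableOn.zpow (Or.inl fun _ hw => hw)).mul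
    (differentiable_sub_zpow 1 (Int.natCast_nonneg k)).differentiableOn

theorem IsOuterContour.psi_sub (h : IsOuterContour p c r) (N : ℕ) (x e t : ℤ) :
    psi p N x c r e t - psi p N x c r e (t + 1) = p * psi p N x c r (e + 1) t := by
  simp only [psi]
  convert h.symbIntegral_sub t e (x + N - 2 - (e + 1) - t) using 3 <;> ring

theorem IsOuterContour.exists_norm_psi_le (h : IsOuterContour p c r) (hp0 : 0 < p) (hp1 : p < 1)
    (N : ℕ) (x e : ℤ) :
    ∃ C : ℝ, 0 ≤ C ∧ ∀ t, x ≤ t → ‖psi p N x c r e t‖ ≤ C * (1 - p / 2) ^ t :=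
  h.exists_norm_symbIntegral_le hp0.le hp1.le e _ x

theorem IsContour.psi_self_eq_zero (h : IsContour p c r) {e : ℤ} (he : 0 ≤ e)
    (heN : e + 2 ≤ N) : psi p N x c r e x = 0 :=
  h.symbIntegral_eq_zero he (Or.inr (by omega))

theorem IsContour.psi_self_neg_one (h : IsContour p c r) (hN : 1 ≤ N) :
    psi p N x c r (-1) x = 1 :=
  h.symbIntegral_neg_one (Or.inr (by omega))

open scoped ComplexConjugate in
theorem Psi_im (p : ℝ) (N : ℕ) (x : ℤ) (k : ℕ) (t : ℤ) : (Psi p N x k t).im = 0 := by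
  rw [← conj_eq_iff_im, Psi, Ftilde, map_mul, map_mul, conj_circleIntegral]
  simp [conj_ofNat]

end Psi

section SingleIntegral

open Complex Metric

variable {p : ℝ} {c c' : ℂ} {r r' : ℝ}

theorem singleIntegral_eq_symbIntegral (hr : 0 ≤ r) (h0 : ∀ w ∈ sphere c r, w ≠ 0)
    (n₁ : ℕ) (τ₁ : ℤ) (n₂ : ℕ) (τ₂ : ℤ) :
    singleIntegral p c r n₁ τ₁ n₂ τ₂ =
      p * symbIntegral p c r (τ₁ - τ₂ - 1) (n₁ - n₂) (τ₂ + n₂ - τ₁ - n₁ - 1) := by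
  rw [singleIntegral, symbIntegral, ← mul_assoc, ← circleIntegral.integral_const_mul]
  refine circleIntegral.integral_congr hr fun z hz => ?_
  have hz0 := h0 z hz
  rw [show τ₂ + n₂ - τ₁ - n₁ - 1 = -2 - (τ₁ - τ₂ - 1) - (n₁ - n₂) by ring, ← symb_zpow_mul hz0,
    zpow_neg, zpow_ofNat]
  field_simp

theorem IsOuterContour.singleIntegral_eq (h : IsOuterContour p c r)
    (n₁ : ℕ) (τ₁ : ℤ) (n₂ : ℕ) (τ₂ : ℤ) :
    singleIntegral p c r n₁ τ₁ n₂ τ₂ =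
      p * symbIntegral p c r (τ₁ - τ₂ - 1) (n₁ - n₂) (τ₂ + n₂ - τ₁ - n₁ - 1) :=
  singleIntegral_eq_symbIntegral h.nonneg (fun _ => h.ne_zero) n₁ τ₁ n₂ τ₂

theorem IsOuterContour.singleIntegral_sub (h : IsOuterContour p c r) (n₁ : ℕ) (τ₁ : ℤ)
    (n₂ : ℕ) (τ₂ : ℤ) :
    singleIntegral p c r n₁ τ₁ n₂ τ₂ - singleIntegral p c r n₁ (τ₁ + 1) n₂ τ₂ =
      p * singleIntegral p c r (n₁ + 1) τ₁ n₂ τ₂ := by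
  simp only [h.singleIntegral_eq]
  rw [← mul_sub]
  congr 1
  convert h.symbIntegral_sub (τ₁ - τ₂ - 1) (n₁ - n₂) (τ₂ + n₂ - τ₁ - n₁ - 2) using 3 <;>
    push_cast <;> ring

theorem IsOuterContour.singleIntegral_eq_zero (h : IsOuterContour p c r) (hp0 : 0 ≤ p)
    (hp1 : p ≤ 1) (n₁ n₂ : ℕ) {τ₁ τ₂ : ℤ} (hτ : τ₂ < τ₁) :
    singleIntegral p c r n₁ τ₁ n₂ τ₂ = 0 := by
  rw [h.singleIntegral_eq, h.symbIntegral_eq_zero_of_add_lt hp0 hp1 (by omega) (by omega),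
    mul_zero]

theorem IsOuterContour.singleIntegral_self (h : IsOuterContour p c r) (hp0 : 0 ≤ p)
    (hp1 : p ≤ 1) (n : ℕ) (τ₁ τ₂ : ℤ) :
    singleIntegral p c r n τ₁ n τ₂ = if τ₁ = τ₂ then 1 else 0 := by
  rcases lt_trichotomy τ₁ τ₂ with hlt | rfl | hgt
  · rw [if_neg hlt.ne, h.singleIntegral_eq, h.symbIntegral_eq_zero (by omega)
      (Or.inr (by omega)), mul_zero]
  · have hres : symbIntegral p c r (-1) (-1) 0 = 1 := h.symbIntegral_neg_one (Or.inr le_rfl)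
    have hinf : symbIntegral p c r 0 (-1) (-1) = 0 :=
      h.symbIntegral_eq_zero_of_add_lt hp0 hp1 le_rfl (by norm_num)
    have hsub := h.symbIntegral_sub (-1) (-1) (-1)
    norm_num [hres, hinf] at hsub
    rw [if_pos rfl, h.singleIntegral_eq]
    ring_nf
    exact hsub.symm
  · rw [if_neg hgt.ne', h.singleIntegral_eq_zero hp0 hp1 n n hgt]

theorem IsInnerContour.singleIntegral_eq (h : IsInnerContour p c r)
    (n₁ : ℕ) (τ₁ : ℤ) (n₂ : ℕ) (τ₂ : ℤ) :
    singleIntegral p c r n₁ τ₁ n₂ τ₂ =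
      p * symbIntegral p c r (τ₁ - τ₂ - 1) (n₁ - n₂) (τ₂ + n₂ - τ₁ - n₁ - 1) :=
  singleIntegral_eq_symbIntegral h.nonneg
    (fun _ hw => h.ne_zero (sphere_subset_closedBall hw)) n₁ τ₁ n₂ τ₂

/-- The transition function `φ^{(n₁,n₂)}(τ₁, τ₂)` from level `n₁` to level `n₂`, which is the second
term of the kernel; it vanishes unless `n₁ < n₂`. -/
noncomputable def transition (p : ℝ) (c : ℂ) (r : ℝ) (n₁ : ℕ) (τ₁ : ℤ) (b : ℕ × ℤ) : ℂ :=
  if n₁ < b.1 then singleIntegral p c r n₁ τ₁ b.1 b.2 else 0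

theorem IsOuterContour.transition_eq_singleIntegral (h : IsOuterContour p c r)
    (h' : IsInnerContour p c' r') (n : ℕ) {τ : ℤ} {b : ℕ × ℤ} (hτ : τ ≤ b.2) :
    transition p c r n τ b = singleIntegral p c' r' n τ b.1 b.2 := by
  rw [transition, h'.singleIntegral_eq]
  split_ifs with hn
  · rw [h.singleIntegral_eq, h.symbIntegral_eq h'.toIsContour (by omega)]
  · rw [h'.symbIntegral_eq_zero (by omega) (Or.inl h'.zero_notMem), mul_zero]

end SingleIntegral

section DoubleIntegral

open Complex Metric

variable {p : ℝ} {c c₀ c₁ v : ℂ} {r r₀ r₁ : ℝ} {f : ℂ → ℂ}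

/-- The Cauchy transform `v ↦ (2πi)⁻¹ ∮ f(w) / (w - v) dw`. -/
noncomputable def cauchyTransform (c : ℂ) (r : ℝ) (f : ℂ → ℂ) (v : ℂ) : ℂ :=
  (2 * Real.pi * I)⁻¹ * ∮ w in C(c, r), (w - v)⁻¹ * f w

theorem cauchyTransform_of_differentiableOn (hf : DifferentiableOn ℂ f (closedBall c r))
    (hv : v ∈ ball c r) : cauchyTransform c r f v = f v := by
  have hres := hf.circleIntegral_sub_inv_smul hv
  simp only [smul_eq_mul] at hres
  rw [cauchyTransform, hres, inv_mul_cancel_left₀ two_pi_I_ne_zero]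

theorem differentiableOn_cauchyTransform (hf : CircleIntegrable f c r) :
    DifferentiableOn ℂ (cauchyTransform c r f) (ball c r) := by
  rcases le_or_gt r 0 with hr | hr
  · simp only [ball_eq_empty.2 hr, differentiableOn_empty]
  · lift r to NNReal using hr.le
    have h := (hasFPowerSeriesOn_cauchy_integral hf (by exact_mod_cast hr)).differentiableOn
    rw [Metric.eball_coe] at h
    exact h

theorem IsOuterContour.circleIntegrable_symbMonomial (h : IsOuterContour p c r) (t e k : ℤ) :
    CircleIntegrable (symbMonomial p t e k) c r :=
  h.toIsContour.circleIntegrable_symbMonomial (fun _ => h.ne_zero) t e k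

theorem IsOuterContour.cauchyTransform_symbMonomial (h : IsOuterContour p c r)
    (hv : v ∈ ball c r) (hv0 : v ≠ 0) (t e k : ℤ) :
    cauchyTransform c r (symbMonomial p t (e + 1) k) v =
      (v - 1) / v * cauchyTransform c r (symbMonomial p t e (k + 1)) v +
        v⁻¹ * symbIntegral p c r t e k := by
  have hinv : ContinuousOn (fun w => (w - v)⁻¹) (sphere c r) := by
    simpa only [zpow_neg_one] using continuousOn_sub_zpow hv (-1)
  rw [← abs_of_nonneg h.nonneg] at hinv
  have hi := h.circleIntegrable_symbMonomial
  rw [cauchyTransform, cauchyTransform, symbIntegral, mul_left_comm ((v - 1) / v),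
    mul_left_comm v⁻¹, ← mul_add, ← circleIntegral.integral_const_mul ((v - 1) / v),
    ← circleIntegral.integral_const_mul v⁻¹, ← circleIntegral.integral_add]
  rotate_left
  · exact ((hi t e (k + 1)).continuousOn_mul hinv).const_smul
  · exact (hi t e k).const_smul
  refine congrArg _ (circleIntegral.integral_congr h.nonneg fun w hw => ?_)
  have hwv : w - v ≠ 0 := sub_ne_zero.2 (ne_of_mem_sphere_of_mem_ball hw hv)
  simp only [symbMonomial, zpow_add_one₀ (h.ne_zero hw), zpow_add_one₀ (h.sub_one_ne_zero hw)]
  field_simp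
  ring

/-- The integral of `symbMonomial p t' e' k'` against the Cauchy transform of
`symbMonomial p t e k`, that is, the double integral of the kernel with its integrand in
polynomial form. -/
noncomputable def crossIntegral (p : ℝ) (c₁ : ℂ) (r₁ : ℝ) (c₀ : ℂ) (r₀ : ℝ)
    (t e k t' e' k' : ℤ) : ℂ :=
  (2 * Real.pi * I)⁻¹ * ∮ v in C(c₁, r₁),
    symbMonomial p t' e' k' v * cauchyTransform c₀ r₀ (symbMonomial p t e k) v

theorem doubleIntegral_eq_crossIntegral (h₀ : IsOuterContour p c₀ r₀)
    (h₁ : IsInnerContour p c₁ r₁) (N : ℕ) (x : ℤ) (n₁ : ℕ) (τ₁ : ℤ) (n₂ : ℕ) (τ₂ : ℤ) :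
    doubleIntegral p N x c₁ r₁ c₀ r₀ n₁ τ₁ n₂ τ₂ =
      p * crossIntegral p c₁ r₁ c₀ r₀ τ₁ n₁ (x + N - 1 - τ₁ - n₁)
        (-τ₂ - 1) (-n₂) (τ₂ + n₂ - x - N) := by
  rw [doubleIntegral, crossIntegral, ← circleIntegral.integral_const_mul (2 * Real.pi * I)⁻¹]
  refine congrArg _ (circleIntegral.integral_congr h₁.nonneg fun v hv => ?_)
  have hv0 : v ≠ 0 := h₁.ne_zero (sphere_subset_closedBall hv)
  rw [cauchyTransform, ← circleIntegral.integral_const_mul (2 * Real.pi * I * v)⁻¹, ← mul_assoc,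
    ← mul_assoc, ← circleIntegral.integral_const_mul]
  refine circleIntegral.integral_congr h₀.nonneg fun w hw => ?_
  have hw0 := h₀.ne_zero hw
  have hτ : τ₂ + n₂ - x - N = -(x + N + 1) - (-τ₂ - 1) - -n₂ := by ring
  rw [hτ, ← symb_zpow_mul hv0, ← symb_zpow_mul hw0, zpow_sub_one₀ hw0, div_zpow w, zpow_neg v,
    zpow_add_one₀ hv0, zpow_natCast, zpow_neg, zpow_natCast,
    show -τ₂ - 1 = -(τ₂ + 1) by ring, zpow_neg]
  simp only [div_eq_mul_inv, mul_inv]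
  ring

theorem IsOuterContour.crossIntegral_add_one (h₀ : IsOuterContour p c₀ r₀)
    (h₁ : IsInnerContour p c₁ r₁) (hsub : closedBall c₁ r₁ ⊆ ball c₀ r₀) (t e k t' e' k' : ℤ) :
    crossIntegral p c₁ r₁ c₀ r₀ t (e + 1) k t' e' (k' + 1) =
      crossIntegral p c₁ r₁ c₀ r₀ t e (k + 1) t' (e' + 1) k' +
        symbIntegral p c₀ r₀ t e k * symbIntegral p c₁ r₁ t' e' k' := by
  have hne : ∀ v ∈ sphere c₁ r₁, v ≠ 0 := fun v hv => h₁.ne_zero (sphere_subset_closedBall hv)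
  have hcont : ContinuousOn (cauchyTransform c₀ r₀ (symbMonomial p t e (k + 1))) (sphere c₁ r₁) :=
    (differentiableOn_cauchyTransform (h₀.circleIntegrable_symbMonomial _ _ _)).continuousOn.mono
      (sphere_subset_closedBall.trans hsub)
  rw [← abs_of_nonneg h₁.nonneg] at hcont
  have hi := h₁.circleIntegrable_symbMonomial hne
  rw [crossIntegral, crossIntegral, symbIntegral, symbIntegral, mul_left_comm, ← mul_add,
    ← circleIntegral.integral_const_mul ((2 * Real.pi * I)⁻¹ * _), ← circleIntegral.integral_add]
  rotate_left
  · exact (hi _ _ _).mul_continuousOn hcont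
  · exact (hi _ _ _).const_smul
  refine congrArg _ (circleIntegral.integral_congr h₁.nonneg fun v hv => ?_)
  have hv0 := hne v hv
  rw [h₀.cauchyTransform_symbMonomial (hsub (sphere_subset_closedBall hv)) hv0, ← symbIntegral]
  simp only [symbMonomial, zpow_add_one₀ hv0, zpow_add_one₀ (h₁.sub_one_ne_zero hv)]
  field_simp

theorem IsOuterContour.crossIntegral_eq_zero (h₀ : IsOuterContour p c₀ r₀)
    (h₁ : IsInnerContour p c₁ r₁) (hsub : closedBall c₁ r₁ ⊆ ball c₀ r₀) (t e k t' : ℤ) {e' : ℤ}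
    (he' : 0 ≤ e') (k' : ℤ) : crossIntegral p c₁ r₁ c₀ r₀ t e k t' e' k' = 0 := by
  rw [crossIntegral, circleIntegral_eq_zero_of_differentiableOn h₁.nonneg, mul_zero]
  exact (differentiableOn_symbMonomial h₁.symbNum_ne_zero he' (Or.inl h₁.zero_notMem)).mul
    ((differentiableOn_cauchyTransform (h₀.circleIntegrable_symbMonomial _ _ _)).mono hsub)

theorem IsOuterContour.crossIntegral_eq_sum (h₀ : IsOuterContour p c₀ r₀)
    (h₁ : IsInnerContour p c₁ r₁) (hsub : closedBall c₁ r₁ ⊆ ball c₀ r₀) (t e k t' e' k' : ℤ)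
    {n : ℕ} (hn : 0 ≤ e' + n) :
    crossIntegral p c₁ r₁ c₀ r₀ t e k t' e' k' = ∑ j ∈ Finset.range n,
      symbIntegral p c₀ r₀ t (e - 1 - j) (k + j) *
        symbIntegral p c₁ r₁ t' (e' + j) (k' - 1 - j) := by
  induction n generalizing e k e' k' with
  | zero => simpa using h₀.crossIntegral_eq_zero h₁ hsub t e k t' (by simpa using hn) k'
  | succ n ih =>
    have hstep := h₀.crossIntegral_add_one h₁ hsub t (e - 1) k t' e' (k' - 1)
    rw [sub_add_cancel, sub_add_cancel] at hstep
    rw [hstep, ih _ _ _ _ (by push_cast at hn; omega), Finset.sum_range_succ']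
    push_cast
    congr 1
    · refine Finset.sum_congr rfl fun j _ => ?_
      congr 2 <;> ring
    · simp

theorem IsOuterContour.crossIntegral_of_nonneg (h₀ : IsOuterContour p c₀ r₀)
    (hsub : closedBall c₁ r₁ ⊆ ball c₀ r₀) (h₁ : IsInnerContour p c₁ r₁) (t : ℤ) {e k : ℤ}
    (he : 0 ≤ e) (hk : 0 ≤ k) (t' e' k' : ℤ) :
    crossIntegral p c₁ r₁ c₀ r₀ t e k t' e' k' =
      symbIntegral p c₁ r₁ (t + t') (e + e') (k + k') := by
  have hne : ∀ v ∈ sphere c₁ r₁, v ≠ 0 := fun v hv => h₁.ne_zero (sphere_subset_closedBall hv)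
  rw [crossIntegral, symbIntegral]
  refine congrArg _ (circleIntegral.integral_congr h₁.nonneg fun v hv => ?_)
  rw [cauchyTransform_of_differentiableOn
    (differentiableOn_symbMonomial h₀.symbNum_ne_zero he (Or.inr hk))
    (hsub (sphere_subset_closedBall hv))]
  simp only [symbMonomial, zpow_add₀ (hne v hv), zpow_add₀ (h₁.sub_one_ne_zero hv),
    zpow_add₀ (h₁.symbNum_ne_zero_of_mem_sphere hv)]
  ring

/-- The functions `Φ` of the paper, biorthogonal to the `Ψ`; the level `n₂` and the index `j` enter
the kernel only through `e = j - n₂`. -/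
noncomputable def dualPsi (p : ℝ) (N : ℕ) (x : ℤ) (c : ℂ) (r : ℝ) (e t : ℤ) : ℂ :=
  p * symbIntegral p c r (-t - 1) e (t - x - N - 1 - e)

theorem IsOuterContour.doubleIntegral_eq_sum (h₀ : IsOuterContour p c₀ r₀)
    (h₁ : IsInnerContour p c₁ r₁) (hsub : closedBall c₁ r₁ ⊆ ball c₀ r₀) (x : ℤ) {N n₂ : ℕ}
    (hn₂ : n₂ ≤ N) (n₁ : ℕ) (τ₁ τ₂ : ℤ) :
    doubleIntegral p N x c₁ r₁ c₀ r₀ n₁ τ₁ n₂ τ₂ = ∑ j : Fin N,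
      psi p N x c₀ r₀ (n₁ - 1 - j) τ₁ * dualPsi p N x c₁ r₁ (j - n₂) τ₂ := by
  rw [doubleIntegral_eq_crossIntegral h₀ h₁, h₀.crossIntegral_eq_sum h₁ hsub (n := N) _ _ _ _ _ _
    (by omega), Finset.mul_sum, Finset.sum_range]
  refine Finset.sum_congr rfl fun j _ => ?_
  rw [psi, dualPsi, mul_left_comm,
    show x + N - 1 - τ₁ - n₁ + (j : ℤ) = x + N - 2 - (n₁ - 1 - j) - τ₁ by ring,
    show τ₂ + n₂ - x - N - 1 - (j : ℤ) = τ₂ - x - N - 1 - (j - n₂) by ring,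
    neg_add_eq_sub]

theorem IsOuterContour.doubleIntegral_bottom (h : IsOuterContour p c r)
    (h₀ : IsOuterContour p c₀ r₀) (h₁ : IsInnerContour p c₁ r₁)
    (hsub : closedBall c₁ r₁ ⊆ ball c₀ r₀) {N n : ℕ} (hn : n < N) {x : ℤ} {b : ℕ × ℤ}
    (hb : x ≤ b.2) :
    doubleIntegral p N x c₁ r₁ c₀ r₀ n x b.1 b.2 = transition p c r n x b := by
  rw [h.transition_eq_singleIntegral h₁ n hb, h₁.singleIntegral_eq,
    doubleIntegral_eq_crossIntegral h₀ h₁,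
    h₀.crossIntegral_of_nonneg hsub h₁ _ (by omega) (by omega)]
  congr 2 <;> ring

end DoubleIntegral

section Tuples

open Finset Matrix

variable {α : Type*} [LinearOrder α] {n : ℕ}

open scoped Classical in
/-- The strictly decreasing `n`-tuples with entries in `s`. -/
noncomputable def strictTuples (s : Finset α) (n : ℕ) : Finset (Fin n → α) :=
  {τ ∈ Fintype.piFinset fun _ => s | StrictAnti τ}

theorem mem_strictTuples {s : Finset α} {τ : Fin n → α} :
    τ ∈ strictTuples s n ↔ (∀ i, τ i ∈ s) ∧ StrictAnti τ := by
  simp [strictTuples, Fintype.mem_piFinset]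

theorem exists_perm_strictAnti {τ : Fin n → α} (h : Function.Injective τ) :
    ∃ σ : Equiv.Perm (Fin n), StrictAnti (τ ∘ σ) :=
  ⟨Tuple.sort (OrderDual.toDual ∘ τ), fun _ _ hij => OrderDual.toDual_lt_toDual.1
    ((Tuple.monotone_sort (OrderDual.toDual ∘ τ)).strictMono_of_injective
      ((OrderDual.toDual.injective.comp h).comp (Equiv.injective _)) hij)⟩

theorem strictAnti_eq_of_comp_perm_eq {τ τ' : Fin n → α} (h : StrictAnti τ) (h' : StrictAnti τ')
    {σ σ' : Equiv.Perm (Fin n)} (he : τ ∘ σ = τ' ∘ σ') : τ = τ' := by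
  have hrange : Set.range τ = Set.range τ' := by
    rw [← σ.surjective.range_comp τ, he, σ'.surjective.range_comp]
  have hdual : OrderDual.toDual ∘ τ = OrderDual.toDual ∘ τ' :=
    (StrictMono.range_inj h.dual_right h'.dual_right).1 (by rw [Set.range_comp, hrange,
      Set.range_comp])
  exact funext fun i => OrderDual.toDual.injective (congrFun hdual i)

open scoped Classical in
theorem sum_strictTuples_perm {M : Type*} [AddCommMonoid M] (s : Finset α) (f : (Fin n → α) → M) :
    ∑ τ ∈ strictTuples s n, ∑ σ : Equiv.Perm (Fin n), f (τ ∘ σ) =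
      ∑ τ ∈ Fintype.piFinset fun _ => s with Function.Injective τ, f τ := by
  rw [← Finset.sum_product']
  refine Finset.sum_bij (fun a _ => a.1 ∘ a.2) ?_ ?_ ?_ (fun _ _ => rfl)
  · rintro ⟨τ, σ⟩ h
    simp only [mem_product, mem_strictTuples, mem_univ, and_true] at h
    simp only [mem_filter, Fintype.mem_piFinset]
    exact ⟨fun i => h.1 _, h.2.injective.comp σ.injective⟩
  · rintro ⟨τ, σ⟩ h ⟨τ', σ'⟩ h' he
    simp only [mem_product, mem_strictTuples, mem_univ, and_true] at h h'
    obtain rfl := strictAnti_eq_of_comp_perm_eq h.2 h'.2 he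
    exact Prod.ext rfl (Equiv.ext fun i => h.2.injective (congrFun he i))
  · intro τ h
    simp only [mem_filter, Fintype.mem_piFinset] at h
    obtain ⟨σ, hσ⟩ := exists_perm_strictAnti h.2
    refine ⟨(τ ∘ σ, σ.symm), ?_, ?_⟩
    · simp only [mem_product, mem_strictTuples, mem_univ, and_true]
      exact ⟨fun i => h.1 _, hσ⟩
    · funext i
      simp

theorem det_sum_mul {R ι α : Type*} [CommRing R] [Fintype ι] [DecidableEq ι] (s : Finset α)
    (a f : ι → α → R) :
    (Matrix.of fun i j => ∑ y ∈ s, a i y * f j y).det =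
      ∑ τ ∈ Fintype.piFinset fun _ : ι => s,
        (∏ i, a i (τ i)) * (Matrix.of fun i j => f j (τ i)).det := by
  have hrows : (Matrix.of fun i j => ∑ y ∈ s, a i y * f j y) =
      fun i => ∑ y ∈ s, a i y • fun j => f j y := by
    ext i j
    simp [Finset.sum_apply]
  rw [hrows]
  refine ((detRowAlternating (n := ι) (R := R)).toMultilinearMap.map_sum_finset
    (fun i y => a i y • fun j => f j y) fun _ => s).trans (Finset.sum_congr rfl fun τ _ => ?_)
  exact (detRowAlternating (n := ι) (R := R)).toMultilinearMap.map_smul_univ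
    (fun i => a i (τ i)) fun i j => f j (τ i)

/-- The Andréief (Cauchy–Binet) identity. -/
theorem sum_strictTuples_det_mul_det {R : Type*} [CommRing R] (s : Finset α)
    (a f : Fin n → α → R) :
    ∑ τ ∈ strictTuples s n,
        (Matrix.of fun i j => a i (τ j)).det * (Matrix.of fun i j => f j (τ i)).det =
      (Matrix.of fun i j => ∑ y ∈ s, a i y * f j y).det := by
  classical
  rw [det_sum_mul, ← Finset.sum_filter_of_ne (s := Fintype.piFinset fun _ : Fin n => s)
    (p := Function.Injective), ← sum_strictTuples_perm]
  · refine Finset.sum_congr rfl fun τ _ => ?_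
    have hperm : ∀ σ : Equiv.Perm (Fin n), (Matrix.of fun i j => f j ((τ ∘ σ) i)).det =
        (Equiv.Perm.sign σ : R) * (Matrix.of fun i j => f j (τ i)).det :=
      fun σ => Matrix.det_permute σ (Matrix.of fun i j => f j (τ i))
    rw [← Matrix.det_transpose, Matrix.det_apply', Finset.sum_mul]
    refine Finset.sum_congr rfl fun σ _ => ?_
    rw [hperm]
    simp only [Matrix.transpose_apply, Matrix.of_apply, Function.comp]
    ring
  · intro τ _ hne i j hij
    by_contra hne'
    refine hne ?_
    rw [Matrix.det_zero_of_row_eq hne' (funext fun k => by simp only [Matrix.of_apply, hij]),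
      mul_zero]

theorem norm_det_le {𝕜 ι : Type*} [NormedField 𝕜] [Fintype ι] [DecidableEq ι]
    (A : Matrix ι ι 𝕜) : ‖A.det‖ ≤ ∑ σ : Equiv.Perm ι, ∏ i, ‖A i (σ i)‖ := by
  rw [← Matrix.det_transpose, Matrix.det_apply]
  refine (norm_sum_le _ _).trans (Finset.sum_le_sum fun σ _ => (le_of_eq ?_))
  rcases Int.units_eq_one_or (Equiv.Perm.sign σ) with h | h <;> simp [h]

theorem sum_strictTuples_norm_det_le {𝕜 : Type*} [NormedField 𝕜] (s : Finset α)
    (b : Fin n → α → 𝕜) :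
    ∑ τ ∈ strictTuples s n, ‖(Matrix.of fun i j => b i (τ j)).det‖ ≤
      ∏ i, ∑ y ∈ s, ‖b i y‖ := by
  classical
  calc ∑ τ ∈ strictTuples s n, ‖(Matrix.of fun i j => b i (τ j)).det‖
      ≤ ∑ τ ∈ strictTuples s n, ∑ σ : Equiv.Perm (Fin n), ∏ i, ‖b i ((τ ∘ σ) i)‖ :=
        Finset.sum_le_sum fun τ _ => norm_det_le _
    _ = ∑ τ ∈ Fintype.piFinset fun _ => s with Function.Injective τ, ∏ i, ‖b i (τ i)‖ :=
        sum_strictTuples_perm s fun τ => ∏ i, ‖b i (τ i)‖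
    _ ≤ ∑ τ ∈ Fintype.piFinset fun _ : Fin n => s, ∏ i, ‖b i (τ i)‖ :=
        Finset.sum_le_sum_of_subset_of_nonneg (Finset.filter_subset _ _)
          fun τ _ _ => Finset.prod_nonneg fun i _ => norm_nonneg _
    _ = ∏ i, ∑ y ∈ s, ‖b i y‖ := (Finset.prod_univ_sum (fun _ => s) fun i y => ‖b i y‖).symm

/-- An identity between sums of determinants that share their last row may be checked on the
minors along that row. -/
theorem sum_mul_det_of_last_row {R ι : Type*} [CommRing R] (s : Finset ι) (w : ι → R)
    (A : ι → Matrix (Fin (n + 1)) (Fin (n + 1)) R) (B : Matrix (Fin (n + 1)) (Fin (n + 1)) R)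
    (hlast : ∀ a j, A a (Fin.last n) j = B (Fin.last n) j)
    (hminor : ∀ j : Fin (n + 1), ∑ a ∈ s, w a * ((A a).submatrix Fin.castSucc j.succAbove).det =
      (B.submatrix Fin.castSucc j.succAbove).det) :
    ∑ a ∈ s, w a * (A a).det = B.det := by
  simp only [Matrix.det_succ_row _ (Fin.last n), hlast, Fin.succAbove_last, ← hminor,
    Finset.mul_sum]
  rw [Finset.sum_comm]
  exact Finset.sum_congr rfl fun j _ => Finset.sum_congr rfl fun a _ => by ring

end Tuples

section Configurations

open Finset

variable {N : ℕ} {x : ℤ}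

/-- The top level `(τ^N_1, …, τ^N_N)` of a configuration. -/
def Config.top (T : Config N x) (i : Fin N) : ℤ := T N (i + 1)

theorem Config.le_top (T : Config N x) (i : Fin N) : x ≤ T.top i :=
  T.lower N (i + 1) (by omega) (by omega) le_rfl

theorem Config.strictAnti_level (T : Config N x) {n : ℕ} (hn : n ≤ N) :
    StrictAnti fun i : Fin n => T n (i + 1) := fun _ _ hij =>
  T.strict n _ _ (by omega) (by simpa using hij) (by omega) hn

theorem Config.strictAnti_top (T : Config N x) : StrictAnti T.top :=
  T.strictAnti_level le_rfl

theorem Config.ext_of_entry_eq {T T' : Config N x}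
    (h : ∀ n i, 1 ≤ i → i ≤ n → n ≤ N → T n i = T' n i) : T = T' := by
  have hentry : T.entry = T'.entry := by
    funext n i
    by_cases hi : 1 ≤ i ∧ i ≤ n ∧ n ≤ N
    · exact h n i hi.1 hi.2.1 hi.2.2
    · rw [T.outside n i hi, T'.outside n i hi]
  cases T
  cases T'
  cases hentry
  rfl

/-- The configuration with a new top level `τ` above the levels of `T`. -/
def Config.snoc (T : Config N x) (τ : Fin (N + 1) → ℤ) (hτ : StrictAnti τ)
    (hx : ∀ i, x ≤ τ i) : Config (N + 1) x where
  entry n i := if h : n = N + 1 ∧ 1 ≤ i ∧ i ≤ N + 1 then τ ⟨i - 1, by omega⟩ else T n i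
  lower n i h1 h2 h3 := by
    split_ifs with h
    · exact hx _
    · exact T.lower n i h1 h2 (by omega)
  strict n i j h1 h2 h3 h4 := by
    by_cases h : n = N + 1
    · rw [dif_pos ⟨h, by omega, by omega⟩, dif_pos ⟨h, by omega, by omega⟩]
      exact hτ (by simp only [Fin.mk_lt_mk]; omega)
    · rw [dif_neg (by omega), dif_neg (by omega)]
      exact T.strict n i j h1 h2 h3 (by omega)
  outside n i h := by
    rw [dif_neg (by omega)]
    exact T.outside n i (by omega)

theorem Config.snoc_of_le (T : Config N x) {τ : Fin (N + 1) → ℤ} (hτ : StrictAnti τ)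
    (hx : ∀ i, x ≤ τ i) {n : ℕ} (hn : n ≤ N) (i : ℕ) : T.snoc τ hτ hx n i = T n i :=
  dif_neg (by omega)

theorem Config.top_snoc (T : Config N x) {τ : Fin (N + 1) → ℤ} (hτ : StrictAnti τ)
    (hx : ∀ i, x ≤ τ i) : (T.snoc τ hτ hx).top = τ :=
  funext fun i => (dif_pos ⟨rfl, by omega, by omega⟩).trans (congrArg τ (Fin.ext (by simp)))

/-- The configuration formed by the levels below the top one. -/
def Config.init (T : Config (N + 1) x) : Config N x where
  entry n i := if n = N + 1 then 0 else T n i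
  lower n i h1 h2 h3 := by rw [if_neg (by omega)]; exact T.lower n i h1 h2 (by omega)
  strict n i j h1 h2 h3 h4 := by
    rw [if_neg (by omega), if_neg (by omega)]; exact T.strict n i j h1 h2 h3 (by omega)
  outside n i h := by
    split_ifs
    · rfl
    · exact T.outside n i (by omega)

theorem Config.init_of_le (T : Config (N + 1) x) {n : ℕ} (hn : n ≤ N) (i : ℕ) :
    T.init n i = T n i :=
  if_neg (by omega)

theorem Config.snoc_init (T : Config (N + 1) x) :
    T.init.snoc T.top T.strictAnti_top T.le_top = T := by
  refine Config.ext_of_entry_eq fun n i h1 h2 h3 => ?_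
  rcases Nat.le_succ_iff.1 h3 with hn | rfl
  · rw [Config.snoc_of_le _ _ _ hn, T.init_of_le hn]
  · obtain ⟨i, rfl⟩ := Nat.exists_eq_add_of_le' h1
    exact congrFun (T.init.top_snoc _ _) ⟨i, by omega⟩

theorem Config.snoc_inj {T T' : Config N x} {τ τ' : Fin (N + 1) → ℤ} {hτ hτ'} {hx hx'}
    (h : T.snoc τ hτ hx = T'.snoc τ' hτ' hx') : T = T' ∧ τ = τ' := by
  constructor
  · exact Config.ext_of_entry_eq fun n i _ _ hn => by
      rw [← T.snoc_of_le hτ hx hn, h, T'.snoc_of_le hτ' hx' hn]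
  · rw [← T.top_snoc hτ hx, h, T'.top_snoc hτ' hx']

/-- The configuration without points. -/
def Config.empty (x : ℤ) : Config 0 x where
  entry _ _ := 0
  lower := by omega
  strict := by omega
  outside _ _ _ := rfl

theorem Config.eq_empty (T : Config 0 x) : T = Config.empty x :=
  Config.ext_of_entry_eq (by omega)

open scoped Classical in
/-- The finite set of configurations all of whose points lie below `L`. -/
noncomputable def truncated (x L : ℤ) : (N : ℕ) → Finset (Config N x)
  | 0 => {Config.empty x}
  | N + 1 => (truncated x L N ×ˢ (strictTuples (Ico x L) (N + 1)).attach).image fun a =>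
      a.1.snoc a.2.1 (mem_strictTuples.1 a.2.2).2
        fun i => (mem_Ico.1 ((mem_strictTuples.1 a.2.2).1 i)).1

theorem mem_truncated {L : ℤ} {T : Config N x} :
    T ∈ truncated x L N ↔ ∀ n i, 1 ≤ i → i ≤ n → n ≤ N → T n i < L := by
  induction N with
  | zero => simp only [truncated, mem_singleton, T.eq_empty, true_iff]; omega
  | succ N ih =>
    simp only [truncated, mem_image, mem_product, mem_attach, and_true, Prod.exists,
      Subtype.exists]
    constructor
    · rintro ⟨T', τ, hτ, hT', rfl⟩ n i h1 h2 h3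
      rcases Nat.le_succ_iff.1 h3 with hn | rfl
      · rw [Config.snoc_of_le _ _ _ hn]
        exact ih.1 hT' n i h1 h2 hn
      · obtain ⟨i, rfl⟩ := Nat.exists_eq_add_of_le' h1
        exact (congrFun (T'.top_snoc _ _) ⟨i, by omega⟩).trans_lt
          (mem_Ico.1 ((mem_strictTuples.1 hτ).1 _)).2
    · intro h
      refine ⟨T.init, T.top, mem_strictTuples.2 ⟨fun i => mem_Ico.2 ⟨T.le_top i, ?_⟩,
        T.strictAnti_top⟩, ih.2 fun n i h1 h2 h3 => ?_, T.snoc_init⟩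
      · exact h _ _ (by omega) (by omega) le_rfl
      · rw [T.init_of_le h3]
        exact h n i h1 h2 (by omega)

theorem sum_truncated_succ {M : Type*} [AddCommMonoid M] (L : ℤ) (F : Config (N + 1) x → M)
    (G : Config N x → (Fin (N + 1) → ℤ) → M)
    (hFG : ∀ T τ hτ hx, F (Config.snoc T τ hτ hx) = G T τ) :
    ∑ T ∈ truncated x L (N + 1), F T =
      ∑ T ∈ truncated x L N, ∑ τ ∈ strictTuples (Ico x L) (N + 1), G T τ := by
  classical
  rw [truncated, Finset.sum_image, Finset.sum_product]
  · simp only [hFG]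
    exact Finset.sum_congr rfl fun T _ => Finset.sum_attach _ fun τ => G T τ
  · rintro ⟨T, τ, hτ⟩ _ ⟨T', τ', hτ'⟩ _ h
    obtain ⟨rfl, rfl⟩ := Config.snoc_inj h
    rfl

open Filter in
theorem tendsto_truncated (N : ℕ) (x : ℤ) :
    Tendsto (fun l : ℕ => truncated x (x + l) N) atTop atTop := by
  refine tendsto_atTop_finset_of_monotone (fun l l' hl T hT => ?_) fun T => ?_
  · refine mem_truncated.2 fun n i h1 h2 h3 => (mem_truncated.1 hT n i h1 h2 h3).trans_le ?_
    gcongr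
  · obtain ⟨L, hL⟩ := ((range (N + 1) ×ˢ range (N + 1)).image fun a => T a.1 a.2).bddAbove
    refine ⟨(L - x).toNat + 1, mem_truncated.2 fun n i _ h2 h3 => ?_⟩
    have hni : T n i ≤ L := hL (mem_coe.2 (mem_image.2 ⟨(n, i), by simp; omega, rfl⟩))
    omega

end Configurations

section Descent

open Finset

/-- Summation against the transition function `φ` over the positions below `L`. -/
noncomputable def stepSum (p : ℝ) (L : ℤ) : (ℤ → ℂ) →ₗ[ℂ] (ℤ → ℂ) where
  toFun f z := p * ∑ y ∈ Ico z L, f y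
  map_add' f g := by
    funext z
    simp only [Pi.add_apply, sum_add_distrib, mul_add]
  map_smul' a f := by
    funext z
    simp only [Pi.smul_apply, smul_eq_mul, ← mul_sum, RingHom.id_apply]
    ring

theorem stepSum_apply (p : ℝ) (L : ℤ) (f : ℤ → ℂ) (z : ℤ) :
    stepSum p L f z = p * ∑ y ∈ Ico z L, f y :=
  rfl

theorem sum_phi_smul {E : Type*} [AddCommGroup E] [Module ℝ E] (p : ℝ) {x z : ℤ} (hz : x ≤ z)
    (L : ℤ) (g : ℤ → E) : ∑ y ∈ Ico x L, phi p z y • g y = p • ∑ y ∈ Ico z L, g y := by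
  have hfilter : {y ∈ Ico x L | z ≤ y} = Ico z L := by
    ext y
    simp only [mem_filter, mem_Ico]
    omega
  simp only [phi, ite_smul, zero_smul]
  rw [← sum_filter, hfilter, smul_sum]

/-- The function `f` on level `n + k`, summed down to level `n` with the factor `D m` inserted on
each level `n < m ≤ n + k`. -/
noncomputable def descend (p : ℝ) (D : ℕ → ℤ → ℂ) (L : ℤ) : ℕ → ℕ → (ℤ → ℂ) → ℤ → ℂ
  | _, 0, f => f
  | n, k + 1, f => stepSum p L (D (n + 1) * descend p D L (n + 1) k f)

theorem descend_succ_eq_descend_stepSum (p : ℝ) (D : ℕ → ℤ → ℂ) (L : ℤ) (n k : ℕ) (f : ℤ → ℂ) :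
    descend p D L n (k + 1) f = descend p D L n k (stepSum p L (D (n + k + 1) * f)) := by
  induction k generalizing n with
  | zero => rfl
  | succ k ih => rw [descend, ih, descend, show n + 1 + k + 1 = n + (k + 1) + 1 by omega]

end Descent

section Weights

open Finset Matrix

variable {N : ℕ} {x : ℤ}

/-- The top level followed by `x`: since `φ(x, y) = p` for all `y ≥ x`, the fictitious variable
`τ^N_{N+1}` may be taken to be `x`. -/
def Config.withFloor (T : Config N x) : Fin (N + 1) → ℤ :=
  Fin.snoc (α := fun _ => ℤ) T.top x

theorem Config.withFloor_castSucc (T : Config N x) (i : Fin N) : T.withFloor i.castSucc = T.top i :=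
  Fin.snoc_castSucc (α := fun _ => ℤ) ..

theorem Config.withFloor_last (T : Config N x) : T.withFloor (Fin.last N) = x :=
  Fin.snoc_last (α := fun _ => ℤ) ..

theorem Config.le_withFloor (T : Config N x) (i : Fin (N + 1)) : x ≤ T.withFloor i := by
  induction i using Fin.lastCases with
  | last => rw [T.withFloor_last]
  | cast i => rw [T.withFloor_castSucc]; exact T.le_top i

/-- The product of the determinants of the transition matrices, a factor of the weight. -/
noncomputable def phiWeight (p : ℝ) (T : Config N x) : ℝ :=
  ∏ n ∈ range N, (phiMatrix p T n).det

/-- The product of the values of `D n` at the points of level `n`, over all levels `n`. -/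
noncomputable def levelProd (D : ℕ → ℤ → ℂ) (T : Config N x) : ℂ :=
  ∏ n ∈ range N, ∏ i : Fin (n + 1), D (n + 1) (T (n + 1) (i + 1))

variable {τ : Fin (N + 1) → ℤ} (hτ : StrictAnti τ) (hx : ∀ i, x ≤ τ i)

theorem phiMatrix_snoc_self (p : ℝ) (T : Config N x) :
    phiMatrix p (T.snoc τ hτ hx) N = of fun i j => phi p (T.withFloor i) (τ j) := by
  have htop (j : Fin (N + 1)) : T.snoc τ hτ hx (N + 1) (j + 1) = τ j :=
    congrFun (T.top_snoc hτ hx) j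
  ext i j
  induction i using Fin.lastCases with
  | last => simp [phiMatrix, T.withFloor_last, phi, hx j]
  | cast i =>
    simp only [phiMatrix, of_apply, htop, Fin.val_castSucc, i.is_lt, if_true,
      T.withFloor_castSucc, T.snoc_of_le hτ hx le_rfl, Config.top]

theorem phiWeight_snoc (p : ℝ) (T : Config N x) :
    phiWeight p (T.snoc τ hτ hx) =
      phiWeight p T * (of fun i j => phi p (T.withFloor i) (τ j)).det := by
  rw [phiWeight, prod_range_succ, phiMatrix_snoc_self]
  refine congrArg (· * _) (prod_congr rfl fun n hn => congrArg det ?_)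
  have hnN : n + 1 ≤ N := mem_range.1 hn
  ext i j
  simp only [phiMatrix, of_apply, T.snoc_of_le hτ hx hnN, T.snoc_of_le hτ hx (n.le_succ.trans hnN)]

theorem levelProd_snoc (D : ℕ → ℤ → ℂ) (T : Config N x) :
    levelProd D (T.snoc τ hτ hx) = levelProd D T * ∏ i, D (N + 1) (τ i) := by
  rw [levelProd, prod_range_succ]
  refine congrArg₂ _ (prod_congr rfl fun n hn => ?_) (prod_congr rfl fun i _ => ?_)
  · simp only [T.snoc_of_le hτ hx (mem_range.1 hn)]
  · exact congrArg _ (congrFun (T.top_snoc hτ hx) i)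

theorem sum_strictTuples_phi_mul_det (p : ℝ) (L : ℤ) (T : Config N x) (d : ℤ → ℂ)
    (f : Fin (N + 1) → ℤ → ℂ) :
    ∑ τ ∈ strictTuples (Ico x L) (N + 1),
        (((of fun i j => phi p (T.withFloor i) (τ j)).det : ℝ) : ℂ) *
          ((∏ i, d (τ i)) * (of fun i j => f j (τ i)).det) =
      (of fun i j => stepSum p L (d * f j) (T.withFloor i)).det := by
  have hstep (i j : Fin (N + 1)) : stepSum p L (d * f j) (T.withFloor i) =
      ∑ y ∈ Ico x L, (phi p (T.withFloor i) y : ℂ) * (d * f j) y := by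
    simpa [stepSum_apply] using (sum_phi_smul p (T.le_withFloor i) L (d * f j)).symm
  simp only [hstep]
  rw [← sum_strictTuples_det_mul_det]
  refine sum_congr rfl fun τ _ => congrArg₂ _ ?_ ?_
  · exact Complex.ofRealHom.map_det _
  · exact (det_mul_column (fun i => d (τ i)) (of fun i j => f j (τ i))).symm

theorem sum_truncated_phiWeight_mul_det (p : ℝ) (D : ℕ → ℤ → ℂ) (x L : ℤ) (f : Fin N → ℤ → ℂ) :
    ∑ T ∈ truncated x L N,
        (phiWeight p T : ℂ) * levelProd D T * (of fun i j => f j (T.top i)).det =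
      (of fun i j : Fin N => descend p D L i (N - i) (f j) x).det := by
  induction N with
  | zero => simp [truncated, phiWeight, levelProd]
  | succ N ih =>
    have hpeel : ∑ T ∈ truncated x L (N + 1),
          (phiWeight p T : ℂ) * levelProd D T * (of fun i j => f j (T.top i)).det =
        ∑ T ∈ truncated x L N, (phiWeight p T : ℂ) * levelProd D T *
          (of fun i j => stepSum p L (D (N + 1) * f j) (T.withFloor i)).det := by
      simp only [← sum_strictTuples_phi_mul_det, mul_sum]
      refine sum_truncated_succ L _ _ fun T τ hτ hx => ?_
      rw [phiWeight_snoc, levelProd_snoc, Config.top_snoc]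
      push_cast
      ring
    rw [hpeel]
    refine sum_mul_det_of_last_row _ _ _ _ (fun T j => ?_) fun j => ?_
    · simp [T.withFloor_last, descend]
    · refine (sum_congr rfl fun T _ => ?_).trans
        ((ih fun k => stepSum p L (D (N + 1) * f (j.succAbove k))).trans (congrArg det ?_))
      · simp only [submatrix, of_apply, T.withFloor_castSucc]
      · ext i k
        have hi : (i : ℕ) + (N - i) + 1 = N + 1 := by omega
        simp only [submatrix_apply, of_apply, Fin.val_castSucc, Nat.sub_add_comm i.is_le']
        rw [descend_succ_eq_descend_stepSum, hi]

end Weights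

section Telescoping

open Finset

theorem sum_Ico_sub_add_one {M : Type*} [AddCommGroup M] (F : ℤ → M) {z L : ℤ} (h : z ≤ L) :
    ∑ y ∈ Ico z L, (F y - F (y + 1)) = F z - F L := by
  induction L, h using Int.leInduction with
  | base => simp
  | succ L hL ih =>
    rw [← insert_Ico_right_eq_Ico_add_one hL, sum_insert right_notMem_Ico, ih]
    abel

theorem sum_Ico_zpow_le {ρ : ℝ} (h0 : 0 < ρ) (h1 : ρ < 1) (z L : ℤ) :
    ∑ y ∈ Ico z L, ρ ^ y ≤ (1 - ρ)⁻¹ * ρ ^ z := by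
  have h1' : 0 < 1 - ρ := sub_pos.2 h1
  rcases le_total z L with h | h
  · have htel := sum_Ico_sub_add_one (fun y => ρ ^ y) h
    simp only [zpow_add_one₀ h0.ne', ← mul_one_sub, ← sum_mul] at htel
    rw [← div_eq_inv_mul, le_div_iff₀ h1', htel]
    linarith [zpow_pos h0 L]
  · rw [Ico_eq_empty_of_le h, sum_empty]
    positivity

end Telescoping

section Bounds

open Finset Matrix

variable {p : ℝ} {N : ℕ} {x : ℤ}

theorem phi_nonneg (hp : 0 ≤ p) (z y : ℤ) : 0 ≤ phi p z y := by
  unfold phi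
  split_ifs
  exacts [hp, le_rfl]

theorem sum_norm_phi_mul_zpow_le (hp : 0 ≤ p) {ρ : ℝ} (h0 : 0 < ρ) (h1 : ρ < 1) {z : ℤ}
    (hz : x ≤ z) (L : ℤ) :
    ∑ y ∈ Ico x L, ‖ρ ^ y * phi p z y‖ ≤ p * (1 - ρ)⁻¹ * ρ ^ z := by
  have hnorm (y : ℤ) : ‖ρ ^ y * phi p z y‖ = phi p z y • ρ ^ y := by
    rw [mul_comm, Real.norm_of_nonneg (mul_nonneg (phi_nonneg hp z y) (zpow_nonneg h0.le y)),
      smul_eq_mul]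
  simp only [hnorm]
  rw [sum_phi_smul p hz, smul_eq_mul, mul_assoc]
  exact mul_le_mul_of_nonneg_left (sum_Ico_zpow_le h0 h1 z L) hp

theorem sum_strictTuples_norm_phi_det_le (hp : 0 ≤ p) {ρ : ℝ} (h0 : 0 < ρ) (h1 : ρ < 1) (L : ℤ)
    (T : Config N x) :
    ∑ τ ∈ strictTuples (Ico x L) (N + 1),
        ‖(of fun i j => phi p (T.withFloor i) (τ j)).det‖ * ∏ i, ρ ^ τ i ≤
      (p * (1 - ρ)⁻¹) ^ (N + 1) * ρ ^ x * ∏ i, ρ ^ T.top i := by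
  calc ∑ τ ∈ strictTuples (Ico x L) (N + 1),
        ‖(of fun i j => phi p (T.withFloor i) (τ j)).det‖ * ∏ i, ρ ^ τ i
      = ∑ τ ∈ strictTuples (Ico x L) (N + 1),
          ‖(of fun i j => ρ ^ τ j * phi p (T.withFloor i) (τ j)).det‖ := by
        refine sum_congr rfl fun τ _ => ?_
        have hcols := det_mul_row (fun j => ρ ^ τ j) (of fun i j => phi p (T.withFloor i) (τ j))
        simp only [of_apply] at hcols
        rw [hcols, norm_mul, mul_comm, Real.norm_of_nonneg (r := ∏ i, ρ ^ τ i) (by positivity)]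
    _ ≤ ∏ i, ∑ y ∈ Ico x L, ‖ρ ^ y * phi p (T.withFloor i) y‖ :=
        sum_strictTuples_norm_det_le (Ico x L) fun i y => ρ ^ y * phi p (T.withFloor i) y
    _ ≤ ∏ i, p * (1 - ρ)⁻¹ * ρ ^ T.withFloor i :=
        prod_le_prod (fun _ _ => by positivity) fun i _ =>
          sum_norm_phi_mul_zpow_le hp h0 h1 (T.le_withFloor i) L
    _ = (p * (1 - ρ)⁻¹) ^ (N + 1) * ρ ^ x * ∏ i, ρ ^ T.top i := by
        rw [prod_mul_distrib, Fin.prod_univ_castSucc fun i => ρ ^ T.withFloor i]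
        simp only [T.withFloor_castSucc, T.withFloor_last, prod_const, card_univ, Fintype.card_fin]
        ring

theorem sum_truncated_norm_phiWeight_le (hp : 0 ≤ p) {ρ : ℝ} (h0 : 0 < ρ) (h1 : ρ < 1)
    (N : ℕ) (x L : ℤ) :
    ∑ T ∈ truncated x L N, ‖phiWeight p T‖ * ∏ i, ρ ^ T.top i ≤
      ∏ n ∈ range N, (p * (1 - ρ)⁻¹) ^ (n + 1) * ρ ^ x := by
  have : 0 ≤ p * (1 - ρ)⁻¹ := mul_nonneg hp (inv_nonneg.2 (by linarith))
  induction N with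
  | zero => simp [truncated, phiWeight]
  | succ N ih =>
    calc ∑ T ∈ truncated x L (N + 1), ‖phiWeight p T‖ * ∏ i, ρ ^ T.top i
        = ∑ T ∈ truncated x L N, ‖phiWeight p T‖ * ∑ τ ∈ strictTuples (Ico x L) (N + 1),
            ‖(of fun i j => phi p (T.withFloor i) (τ j)).det‖ * ∏ i, ρ ^ τ i := by
          simp only [mul_sum]
          refine sum_truncated_succ L _ _ fun T τ hτ hx => ?_
          rw [phiWeight_snoc, norm_mul, Config.top_snoc, mul_assoc]
      _ ≤ ∑ T ∈ truncated x L N, ‖phiWeight p T‖ *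
            ((p * (1 - ρ)⁻¹) ^ (N + 1) * ρ ^ x * ∏ i, ρ ^ T.top i) := by
          gcongr with T _
          exact sum_strictTuples_norm_phi_det_le hp h0 h1 L T
      _ = (∑ T ∈ truncated x L N, ‖phiWeight p T‖ * ∏ i, ρ ^ T.top i) *
            ((p * (1 - ρ)⁻¹) ^ (N + 1) * ρ ^ x) := by
          rw [sum_mul]
          exact sum_congr rfl fun T _ => by ring
      _ ≤ (∏ n ∈ range N, (p * (1 - ρ)⁻¹) ^ (n + 1) * ρ ^ x) *
            ((p * (1 - ρ)⁻¹) ^ (N + 1) * ρ ^ x) := by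
          gcongr
      _ = _ := (prod_range_succ _ _).symm

end Bounds

section Weight

open Finset Matrix Filter Metric

variable {p : ℝ} {N : ℕ} {x : ℤ} {c : ℂ} {r : ℝ}

theorem norm_det_le_of_norm_le {𝕜 ι : Type*} [NormedField 𝕜] [Fintype ι] [DecidableEq ι]
    {A : Matrix ι ι 𝕜} {u v : ι → ℝ} (h : ∀ i j, ‖A i j‖ ≤ u i * v j) :
    ‖A.det‖ ≤ (Fintype.card ι).factorial * ((∏ i, u i) * ∏ i, v i) := by
  have hσ (σ : Equiv.Perm ι) : ∏ i, ‖A i (σ i)‖ ≤ (∏ i, u i) * ∏ i, v i := by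
    rw [← Equiv.prod_comp σ v, ← prod_mul_distrib]
    exact prod_le_prod (fun _ _ => norm_nonneg _) fun i _ => h i (σ i)
  refine (norm_det_le A).trans ((sum_le_sum fun σ _ => hσ σ).trans_eq ?_)
  rw [sum_const, card_univ, Fintype.card_perm, nsmul_eq_mul]

theorem PsiMatrix_det (p : ℝ) (T : Config N x) :
    (PsiMatrix p T).det = (of fun i j : Fin N => Psi p N x j.rev (T.top i)).det := by
  rw [← det_transpose, ← det_submatrix_equiv_self Fin.revPerm]
  congr 1
  ext i j
  have hi : N - (N - ((i : ℕ) + 1)) = i + 1 := by omega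
  simp [PsiMatrix, Config.top, Fin.val_rev, hi]

theorem IsOuterContour.weight_eq (h : IsOuterContour p c r) (hp0 : 0 < p) (hp1 : p < 1)
    (T : Config N x) :
    weight p T =
      phiWeight p T * (of fun i j : Fin N => psi p N x c r (N - 1 - j) (T.top i)).det := by
  rw [weight, PsiMatrix_det, phiWeight]
  refine congrArg (_ * det ·) ?_
  ext i j
  rw [of_apply, of_apply, h.Psi_eq_psi hp0 hp1, show ((j.rev : ℕ) : ℤ) = N - 1 - j by
    rw [Fin.val_rev]; omega]

theorem weight_im (p : ℝ) (T : Config N x) : (weight p T).im = 0 := by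
  have hreal : PsiMatrix p T = ((PsiMatrix p T).map Complex.re).map Complex.ofRealHom := by
    ext i j
    exact Complex.ext rfl (Psi_im p N x _ _)
  rw [weight, hreal, ← RingHom.mapMatrix_apply, ← RingHom.map_det, Complex.ofRealHom_eq_coe,
    ← Complex.ofReal_mul, Complex.ofReal_im]

theorem exists_isOuterContour (hp0 : 0 < p) (hp1 : p < 1) :
    ∃ (c : ℂ) (r : ℝ), IsOuterContour p c r := by
  have hp : p ≤ p / (1 - p) := le_div_self hp0.le (by linarith) (by linarith)
  refine ⟨((1 / 2 : ℝ) : ℂ), (1 + p) / 2, IsContour.of_notMem hp1 ?_ ?_, ?_⟩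
  · rw [mem_ball, dist_eq_norm, ← Complex.ofReal_one, ← Complex.ofReal_sub, Complex.norm_real]
    norm_num
    linarith
  · have hcast : (-(p / (1 - p)) : ℂ) = ((-(p / (1 - p)) : ℝ) : ℂ) := by push_cast; rfl
    rw [mem_closedBall, dist_eq_norm, hcast, ← Complex.ofReal_sub, Complex.norm_real,
      Real.norm_eq_abs, not_le, lt_abs]
    right
    linarith
  · rw [mem_ball, dist_eq_norm, zero_sub, norm_neg, Complex.norm_real]
    norm_num
    linarith

theorem exists_norm_weight_le (hp0 : 0 < p) (hp1 : p < 1) (N : ℕ) (x : ℤ) :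
    ∃ C : ℝ, 0 ≤ C ∧ ∀ T : Config N x,
      ‖weight p T‖ ≤ C * (‖phiWeight p T‖ * ∏ i, (1 - p / 2) ^ T.top i) := by
  obtain ⟨c, r, h⟩ := exists_isOuterContour hp0 hp1
  choose C hC0 hC using fun j : Fin N => h.exists_norm_psi_le hp0 hp1 N x (N - 1 - j)
  refine ⟨(Fintype.card (Fin N)).factorial * ∏ j, C j, mul_nonneg (Nat.cast_nonneg _)
    (prod_nonneg fun j _ => hC0 j), fun T => ?_⟩
  have hdet := norm_det_le_of_norm_le
    (A := of fun i j : Fin N => psi p N x c r (N - 1 - j) (T.top i))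
    (u := fun i => (1 - p / 2) ^ T.top i) (v := C)
    fun i j => (hC j _ (T.le_top i)).trans_eq (mul_comm _ _)
  rw [h.weight_eq hp0 hp1, norm_mul, Complex.norm_real]
  refine (mul_le_mul_of_nonneg_left hdet (norm_nonneg _)).trans_eq ?_
  ring

theorem summable_norm_weight (hp0 : 0 < p) (hp1 : p < 1) (N : ℕ) (x : ℤ) :
    Summable fun T : Config N x => ‖weight p T‖ := by
  obtain ⟨C, hC0, hC⟩ := exists_norm_weight_le hp0 hp1 N x
  refine summable_of_sum_le
    (c := C * ∏ n ∈ range N, (p * (1 - (1 - p / 2))⁻¹) ^ (n + 1) * (1 - p / 2) ^ x)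
    (fun T => norm_nonneg _) fun s => ?_
  obtain ⟨l, hl⟩ := ((tendsto_truncated N x).eventually_ge_atTop s).exists
  calc ∑ T ∈ s, ‖weight p T‖
      ≤ ∑ T ∈ truncated x (x + l) N, ‖weight p T‖ :=
        sum_le_sum_of_subset_of_nonneg hl fun _ _ _ => norm_nonneg _
    _ ≤ ∑ T ∈ truncated x (x + l) N, C * (‖phiWeight p T‖ * ∏ i, (1 - p / 2) ^ T.top i) :=
        sum_le_sum fun T _ => hC T
    _ ≤ C * _ := by
        rw [← mul_sum]
        exact mul_le_mul_of_nonneg_left (sum_truncated_norm_phiWeight_le hp0.le (by linarith)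
          (by linarith) N x _) hC0

end Weight

section Duhamel

open Finset

variable {p : ℝ} {c : ℂ} {r : ℝ} {L z : ℤ}

theorem stepSum_congr (p : ℝ) {f g : ℤ → ℂ} (h : ∀ y < L, f y = g y) :
    stepSum p L f = stepSum p L g :=
  funext fun z => by
    rw [stepSum_apply, stepSum_apply, sum_congr rfl fun y hy => h y (mem_Ico.1 hy).2]

theorem stepSum_eq_sub {F f : ℤ → ℂ} (hF : ∀ y, F y - F (y + 1) = p * f y) (hz : z ≤ L) :
    stepSum p L f z = F z - F L := by
  simp only [stepSum_apply, mul_sum, ← hF]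
  exact sum_Ico_sub_add_one F hz

theorem IsOuterContour.stepSum_transition (h : IsOuterContour p c r) (hp0 : 0 ≤ p) (hp1 : p ≤ 1)
    (n : ℕ) {b : ℕ × ℤ} (hz : z ≤ L) (hb : b.2 < L) :
    stepSum p L (fun y => transition p c r (n + 1) y b + if b = (n + 1, y) then 1 else 0) z =
      transition p c r n z b := by
  obtain ⟨n₂, τ⟩ := b
  simp only [transition, Prod.mk.injEq]
  rcases lt_or_ge n n₂ with hn | hn
  · have hsummand (y : ℤ) : ((if n + 1 < n₂ then singleIntegral p c r (n + 1) y n₂ τ else 0) +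
        if n₂ = n + 1 ∧ τ = y then (1 : ℂ) else 0) = singleIntegral p c r (n + 1) y n₂ τ := by
      rcases (Nat.succ_le_of_lt hn).lt_or_eq with hlt | rfl
      · simp [hlt, hlt.ne']
      · simp [h.singleIntegral_self hp0 hp1, eq_comm]
    simp only [hsummand]
    rw [if_pos hn, stepSum_eq_sub (fun y => h.singleIntegral_sub n y n₂ τ) hz,
      h.singleIntegral_eq_zero hp0 hp1 n n₂ hb, sub_zero]
  · simp [stepSum_apply, hn.not_gt, (show ¬ n + 1 < n₂ by omega), (show n₂ ≠ n + 1 by omega)]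

/-- The weight `1 + g` at the points `a b`, and `1` elsewhere. -/
noncomputable def pointWeight {m : ℕ} (g : ℂ) (a : Fin m → ℕ × ℤ) (n : ℕ) (y : ℤ) : ℂ :=
  1 + g * ∑ b, if a b = (n, y) then 1 else 0

/-- The last passage of the summation through a marked point splits off a transition function. -/
theorem IsOuterContour.descend_pointWeight (h : IsOuterContour p c r) (hp0 : 0 ≤ p) (hp1 : p ≤ 1)
    {m : ℕ} (g : ℂ) {a : Fin m → ℕ × ℤ} {n k : ℕ} (ha : ∀ b, (a b).1 ≤ n + k)
    (haL : ∀ b, (a b).2 < L) (f : ℤ → ℂ) (hz : z ≤ L) :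
    descend p (pointWeight g a) L n k f z =
      descend p 1 L n k f z + g * ∑ b, transition p c r n z (a b) *
        descend p (pointWeight g a) L (a b).1 (n + k - (a b).1) f (a b).2 := by
  induction k generalizing n z with
  | zero =>
    have htrans (b : Fin m) : transition p c r n z (a b) = 0 := if_neg (ha b).not_gt
    simp [descend, htrans]
  | succ k ih =>
    have hlevel : n + 1 + k = n + (k + 1) := by omega
    rw [← hlevel]
    set H : Fin m → ℂ := fun b =>
      descend p (pointWeight g a) L (a b).1 (n + 1 + k - (a b).1) f (a b).2
    set u := descend p (pointWeight g a) L (n + 1) k f with hu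
    have hmark (b : Fin m) (y : ℤ) :
        (if a b = (n + 1, y) then (1 : ℂ) else 0) * u y =
          (if a b = (n + 1, y) then 1 else 0) * H b := by
      split_ifs with hab
      · simp only [H, hab, hu, Nat.add_sub_cancel_left]
      · simp
    have hsummand : ∀ y < L, (pointWeight g a (n + 1) * u) y =
        (descend p 1 L (n + 1) k f + g • ∑ b, H b • fun y =>
          transition p c r (n + 1) y (a b) + if a b = (n + 1, y) then 1 else 0) y := by
      intro y hy
      have hy' : u y = descend p 1 L (n + 1) k f y +
          g * ∑ b, transition p c r (n + 1) y (a b) * H b :=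
        ih (fun b => hlevel ▸ ha b) hy.le
      simp only [Pi.mul_apply, Pi.add_apply, Pi.smul_apply, Finset.sum_apply, smul_eq_mul,
        pointWeight, add_mul, one_mul, mul_assoc, sum_mul, hmark, mul_add, sum_add_distrib]
      rw [hy', add_assoc]
      simp only [mul_comm (H _)]
    rw [descend, stepSum_congr p hsummand, descend, Pi.one_apply, one_mul, map_add, map_smul,
      map_sum]
    simp only [map_smul, Pi.add_apply, Pi.smul_apply, Finset.sum_apply, smul_eq_mul,
      h.stepSum_transition hp0 hp1 n hz (haL _), mul_comm (H _)]
    rfl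

end Duhamel

section Limits

open Finset Filter Topology

variable {p : ℝ} {c : ℂ} {r : ℝ} {L z : ℤ}

theorem norm_stepSum_le (hp0 : 0 ≤ p) (hp1 : p ≤ 1) {f : ℤ → ℂ} {B : ℝ}
    (h : ∀ y, z ≤ y → y < L → ‖f y‖ ≤ B) : ‖stepSum p L f z‖ ≤ (L - z).toNat * B := by
  rw [stepSum_apply, norm_mul, Complex.norm_real, Real.norm_of_nonneg hp0]
  refine (mul_le_of_le_one_left (norm_nonneg _) hp1).trans ?_
  refine (norm_sum_le_of_le _ fun y hy => h y (mem_Ico.1 hy).1 (mem_Ico.1 hy).2).trans_eq ?_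
  rw [sum_const, Int.card_Ico, nsmul_eq_mul]

theorem IsOuterContour.exists_norm_psi_sub_descend_le (h : IsOuterContour p c r) (hp0 : 0 < p)
    (hp1 : p < 1) (N : ℕ) (x e : ℤ) (k : ℕ) :
    ∃ C : ℝ, 0 ≤ C ∧ ∀ (n l : ℕ) (z : ℤ), x ≤ z → z ≤ x + l →
      ‖psi p N x c r (e - k) z - descend p 1 (x + l) n k (psi p N x c r e) z‖ ≤
        C * ((l + 1) ^ k * (1 - p / 2) ^ l) := by
  have hρ : 0 < 1 - p / 2 := by linarith
  induction k with
  | zero => exact ⟨0, le_rfl, by simp [descend]⟩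
  | succ k ih =>
    obtain ⟨C, hC0, hC⟩ := ih
    obtain ⟨C', hC'0, hC'⟩ := h.exists_norm_psi_le hp0 hp1 N x (e - (k + 1 : ℕ))
    refine ⟨C' * (1 - p / 2) ^ x + C, by positivity, fun n l z hxz hz => ?_⟩
    set δ : ℤ → ℂ := psi p N x c r (e - k) - descend p 1 (x + l) (n + 1) k (psi p N x c r e)
    have hδ : psi p N x c r (e - (k + 1 : ℕ)) z -
          descend p 1 (x + l) n (k + 1) (psi p N x c r e) z =
        psi p N x c r (e - (k + 1 : ℕ)) (x + l) + stepSum p (x + l) δ z := by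
      have htel := stepSum_eq_sub (h.psi_sub N x (e - (k + 1 : ℕ))) hz
      rw [show e - (k + 1 : ℕ) + 1 = e - k by push_cast; ring] at htel
      rw [descend, map_sub, Pi.sub_apply, Pi.one_apply, one_mul, htel]
      ring
    have hboundary := hC' (x + l) (by omega)
    rw [zpow_add₀ hρ.ne', zpow_natCast, ← mul_assoc] at hboundary
    have hstep : ‖stepSum p (x + l) δ z‖ ≤ l * (C * ((l + 1) ^ k * (1 - p / 2) ^ l)) := by
      refine (norm_stepSum_le hp0.le hp1.le fun y hy hy' =>
        hC (n + 1) l y (hxz.trans hy) hy'.le).trans ?_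
      gcongr
      omega
    have hpow : (1 : ℝ) ≤ (l + 1) ^ (k + 1) := one_le_pow₀ (by simp)
    rw [hδ]
    calc _ ≤ C' * (1 - p / 2) ^ x * (1 - p / 2) ^ l +
          l * (C * ((l + 1) ^ k * (1 - p / 2) ^ l)) := norm_add_le_of_le hboundary hstep
      _ ≤ C' * (1 - p / 2) ^ x * ((l + 1) ^ (k + 1) * (1 - p / 2) ^ l) +
          (l + 1) * (C * ((l + 1) ^ k * (1 - p / 2) ^ l)) := by
        gcongr
        · exact le_mul_of_one_le_left (by positivity) hpow
        · linarith
      _ = _ := by ring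

theorem tendsto_add_one_pow_mul_pow {ρ : ℝ} (h0 : 0 < ρ) (h1 : ρ < 1) (k : ℕ) :
    Tendsto (fun l : ℕ => ((l : ℝ) + 1) ^ k * ρ ^ l) atTop (𝓝 0) := by
  have h := ((tendsto_add_atTop_iff_nat 1).2
    (tendsto_pow_const_mul_const_pow_of_abs_lt_one k (by rwa [abs_of_pos h0]))).mul_const ρ⁻¹
  rw [zero_mul] at h
  refine h.congr fun l => ?_
  rw [pow_succ ρ, ← mul_assoc, mul_inv_cancel_right₀ h0.ne', Nat.cast_add_one]

theorem IsOuterContour.tendsto_descend (h : IsOuterContour p c r) (hp0 : 0 < p) (hp1 : p < 1)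
    (N : ℕ) {x : ℤ} (hz : x ≤ z) (e : ℤ) (n k : ℕ) :
    Tendsto (fun l : ℕ => descend p 1 (x + l) n k (psi p N x c r e) z) atTop
      (𝓝 (psi p N x c r (e - k) z)) := by
  obtain ⟨C, -, hC⟩ := h.exists_norm_psi_sub_descend_le hp0 hp1 N x e k
  have hlim := (tendsto_add_one_pow_mul_pow (ρ := 1 - p / 2) (by linarith) (by linarith)
    k).const_mul C
  rw [mul_zero] at hlim
  rw [tendsto_iff_norm_sub_tendsto_zero]
  refine squeeze_zero' (Eventually.of_forall fun _ => norm_nonneg _) ?_ hlim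
  filter_upwards [eventually_ge_atTop (z - x).toNat] with l hl
  rw [norm_sub_rev]
  exact hC n l z hz (by omega)

end Limits

section Determinants

open Finset Matrix

theorem det_one_sub_of_strict {R ι α : Type*} [CommRing R] [Fintype ι] [DecidableEq ι]
    [LinearOrder α] {level : ι → α} {Φ : Matrix ι ι R}
    (hΦ : ∀ i j, level j ≤ level i → Φ i j = 0) : (1 - Φ).det = 1 := by
  have htri : (1 - Φ).BlockTriangular level := fun i j hij => by
    rw [Matrix.sub_apply, hΦ i j hij.le, one_apply_ne (by rintro rfl; exact hij.false), sub_zero]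
  rw [htri.det]
  refine prod_eq_one fun k _ => ?_
  have hblock : (1 - Φ).toSquareBlock level k = 1 := by
    ext i j
    simp [toSquareBlock, toSquareBlockProp, hΦ i.1 j.1 (i.2.trans j.2.symm).ge, one_apply,
      Subtype.ext_iff]
  rw [hblock, det_one]

theorem det_add_mul_inv_mul {R ι κ : Type*} [CommRing R] [Fintype ι] [DecidableEq ι] [Fintype κ]
    [DecidableEq κ] {A : Matrix κ κ R} (hA : A.det = 1) (P : Matrix ι ι R) (U : Matrix κ ι R)
    (V : Matrix ι κ R) : (P + P * V * (A⁻¹ * U)).det = P.det * (A + U * V).det := by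
  rw [det_add_mul U V (hA ▸ isUnit_one), hA, one_mul, ← det_mul, Matrix.mul_add,
    Matrix.mul_one]
  simp only [Matrix.mul_assoc]

end Determinants

section MarkedPoints

open Finset Matrix

variable {N m : ℕ} {x : ℤ}

theorem norm_prod_ite_le {ι : Type*} [Fintype ι] (P : ι → Prop) [DecidablePred P] {u v : ℂ}
    {B : ℝ} (hu : ‖u‖ ≤ B) (hv : ‖v‖ ≤ B) :
    ‖∏ i, if P i then u else v‖ ≤ B ^ Fintype.card ι := by
  rw [norm_prod, ← card_univ, ← prod_const]
  refine prod_le_prod (fun _ _ => norm_nonneg _) fun i _ => ?_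
  split_ifs
  exacts [hu, hv]

theorem pointWeight_eq_prod (g : ℂ) {a : Fin m → ℕ × ℤ} (ha : Function.Injective a) (n : ℕ)
    (y : ℤ) : pointWeight g a n y = ∏ b, if a b = (n, y) then 1 + g else 1 := by
  have hunique : ∀ b ∈ univ, ∀ b' ∈ univ, a b = (n, y) → a b' = (n, y) → b = b' :=
    fun b _ b' _ h h' => ha (h.trans h'.symm)
  rw [pointWeight, sum_ite_zero _ _ hunique, prod_ite_one _ _ hunique]
  split_ifs <;> simp

theorem Config.mem_points_iff {T : Config N x} {b : ℕ × ℤ} (hb : 1 ≤ b.1) :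
    b ∈ T.points ↔ ∃ n < N, ∃ i : Fin (n + 1), b = (n + 1, T (n + 1) (i + 1)) := by
  constructor
  · obtain ⟨n, y⟩ := b
    obtain ⟨n, rfl⟩ := Nat.exists_eq_add_of_le' hb
    rintro ⟨hn, i, hi, hin, hT⟩
    obtain ⟨i, rfl⟩ := Nat.exists_eq_add_of_le' hi
    exact ⟨n, hn, ⟨i, hin⟩, Prod.ext rfl hT.symm⟩
  · rintro ⟨n, hn, i, rfl⟩
    exact ⟨hn, i + 1, by omega, i.is_lt, rfl⟩

open scoped Classical in
theorem Config.prod_ite_eq_point (T : Config N x) {b : ℕ × ℤ} (hb : 1 ≤ b.1) (u : ℂ) :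
    ∏ n ∈ range N, ∏ i : Fin (n + 1), (if b = (n + 1, T (n + 1) (i + 1)) then u else 1) =
      if b ∈ T.points then u else 1 := by
  rw [prod_sigma', prod_ite_one]
  · simp only [T.mem_points_iff hb, Sigma.exists, mem_sigma, mem_range, mem_univ, and_true,
      exists_and_left]
  · rintro ⟨n, i⟩ hn ⟨n', i'⟩ _ hi hi'
    obtain ⟨hnn', hT⟩ := Prod.mk.inj (hi.symm.trans hi')
    obtain rfl : n = n' := Nat.add_right_cancel hnn'
    obtain rfl : i = i' := (T.strictAnti_level (mem_range.1 (mem_sigma.1 hn).1)).injective hT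
    rfl

open scoped Classical in
theorem levelProd_pointWeight (g : ℂ) {a : Fin m → ℕ × ℤ} (ha : Function.Injective a)
    (ha1 : ∀ b, 1 ≤ (a b).1) (T : Config N x) :
    levelProd (pointWeight g a) T = ∏ b, if a b ∈ T.points then 1 + g else 1 := by
  simp only [levelProd, pointWeight_eq_prod g ha, ← T.prod_ite_eq_point (ha1 _)]
  rw [prod_congr rfl fun n _ => prod_comm, prod_comm]

end MarkedPoints

section Matrices

open Finset Matrix Filter Metric Topology

variable {p : ℝ} {c c₀ c₁ : ℂ} {r r₀ r₁ : ℝ} {N m : ℕ} {x : ℤ} {ι : Type*}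

/-- The matrix of the values at the points `b i = (n, τ)` of the functions `Ψ^n_j`, with the columns
in decreasing order of the index `j` at the top level. -/
noncomputable def psiMatrix (p : ℝ) (N : ℕ) (x : ℤ) (c : ℂ) (r : ℝ) (b : ι → ℕ × ℤ) :
    Matrix ι (Fin N) ℂ :=
  of fun i j => psi p N x c r ((b i).1 - 1 - j) (b i).2

/-- The matrix of the values at the points `a i` of the functions biorthogonal to those in
`psiMatrix`. -/
noncomputable def dualPsiMatrix (p : ℝ) (N : ℕ) (x : ℤ) (c : ℂ) (r : ℝ) (a : Fin m → ℕ × ℤ) :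
    Matrix (Fin N) (Fin m) ℂ :=
  of fun j i => dualPsi p N x c r (j - (a i).1) (a i).2

/-- The matrix of the transition functions from the points `b i` to the points `a j`. -/
noncomputable def transitionMatrix (p : ℝ) (c : ℂ) (r : ℝ) (b : ι → ℕ × ℤ) (a : Fin m → ℕ × ℤ) :
    Matrix ι (Fin m) ℂ :=
  of fun i j => transition p c r (b i).1 (b i).2 (a j)

/-- The matrix of the values at the points `b i` of the functions `f j` on level `N`, summed down as
in `descend`. -/
noncomputable def descendMatrix (p : ℝ) (D : ℕ → ℤ → ℂ) (L : ℤ) (f : Fin N → ℤ → ℂ)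
    (b : ι → ℕ × ℤ) : Matrix ι (Fin N) ℂ :=
  of fun i j => descend p D L (b i).1 (N - (b i).1) (f j) (b i).2

/-- The points `(0, x), …, (N - 1, x)`, which stand for the fictitious variables. -/
def floorPoint (N : ℕ) (x : ℤ) (i : Fin N) : ℕ × ℤ :=
  (i, x)

theorem IsOuterContour.det_psiMatrix_floorPoint (h : IsOuterContour p c r) (N : ℕ) (x : ℤ) :
    (psiMatrix p N x c r (floorPoint N x)).det = 1 := by
  have htri : (psiMatrix p N x c r (floorPoint N x)).IsUpperTriangular := fun i j hij => by
    have hji : (j : ℕ) < i := hij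
    exact h.psi_self_eq_zero (by simp only [floorPoint]; omega) (by simp only [floorPoint]; omega)
  rw [det_of_isUpperTriangular htri]
  refine prod_eq_one fun i _ => ?_
  simpa [psiMatrix, floorPoint] using h.psi_self_neg_one i.pos

theorem IsOuterContour.doubleIntegral_matrix_eq (h₀ : IsOuterContour p c₀ r₀)
    (h₁ : IsInnerContour p c₁ r₁) (hsub : closedBall c₁ r₁ ⊆ ball c₀ r₀) (x : ℤ) (b : ι → ℕ × ℤ)
    {a : Fin m → ℕ × ℤ} (ha : ∀ i, (a i).1 ≤ N) :
    (of fun i j => doubleIntegral p N x c₁ r₁ c₀ r₀ (b i).1 (b i).2 (a j).1 (a j).2) =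
      psiMatrix p N x c₀ r₀ b * dualPsiMatrix p N x c₁ r₁ a := by
  ext i j
  exact h₀.doubleIntegral_eq_sum h₁ hsub x (ha j) (b i).1 (b i).2 (a j).2

theorem IsOuterContour.kernel_matrix_eq (h₀ : IsOuterContour p c₀ r₀)
    (h₁ : IsInnerContour p c₁ r₁) (hsub : closedBall c₁ r₁ ⊆ ball c₀ r₀) (x : ℤ) (c : ℂ) (r : ℝ)
    {a : Fin m → ℕ × ℤ} (ha : ∀ i, (a i).1 ≤ N) :
    (of fun i j => kernel p N x c₁ r₁ c₀ r₀ c r (a i) (a j)) =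
      psiMatrix p N x c₀ r₀ a * dualPsiMatrix p N x c₁ r₁ a - transitionMatrix p c r a a := by
  rw [← h₀.doubleIntegral_matrix_eq h₁ hsub x a ha]
  rfl

theorem IsOuterContour.psiMatrix_floorPoint_mul_dualPsiMatrix (h : IsOuterContour p c r)
    (h₀ : IsOuterContour p c₀ r₀) (h₁ : IsInnerContour p c₁ r₁)
    (hsub : closedBall c₁ r₁ ⊆ ball c₀ r₀) {a : Fin m → ℕ × ℤ}
    (ha : ∀ i, (a i).1 ≤ N ∧ x ≤ (a i).2) :
    psiMatrix p N x c₀ r₀ (floorPoint N x) * dualPsiMatrix p N x c₁ r₁ a =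
      transitionMatrix p c r (floorPoint N x) a := by
  rw [← h₀.doubleIntegral_matrix_eq h₁ hsub x _ fun i => (ha i).1]
  ext i j
  exact h.doubleIntegral_bottom h₀ h₁ hsub i.is_lt (ha j).2

theorem det_one_sub_smul_transitionMatrix (p : ℝ) (c : ℂ) (r : ℝ) (a : Fin m → ℕ × ℤ) (g : ℂ) :
    (1 - g • transitionMatrix p c r a a).det = 1 :=
  det_one_sub_of_strict (level := fun i => (a i).1) fun _ _ hij =>
    mul_eq_zero_of_right g (if_neg hij.not_gt)

theorem IsOuterContour.descendMatrix_pointWeight (h : IsOuterContour p c r) (hp0 : 0 ≤ p)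
    (hp1 : p ≤ 1) (g : ℂ) {L : ℤ} {a : Fin m → ℕ × ℤ} (ha : ∀ i, (a i).1 ≤ N ∧ (a i).2 < L)
    (f : Fin N → ℤ → ℂ) {b : ι → ℕ × ℤ} (hb : ∀ i, (b i).1 ≤ N ∧ (b i).2 ≤ L) :
    descendMatrix p (pointWeight g a) L f b =
      descendMatrix p 1 L f b +
        g • (transitionMatrix p c r b a * descendMatrix p (pointWeight g a) L f a) := by
  ext i j
  have hlevel : (b i).1 + (N - (b i).1) = N := Nat.add_sub_cancel' (hb i).1
  have hdescend := h.descend_pointWeight hp0 hp1 g (n := (b i).1) (k := N - (b i).1)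
    (fun i => hlevel.symm ▸ (ha i).1) (fun i => (ha i).2) (f j) (hb i).2
  rwa [hlevel] at hdescend

theorem IsOuterContour.descendMatrix_pointWeight_eq_inv_mul (h : IsOuterContour p c r)
    (hp0 : 0 ≤ p) (hp1 : p ≤ 1) (g : ℂ) {L : ℤ} {a : Fin m → ℕ × ℤ}
    (ha : ∀ i, (a i).1 ≤ N ∧ (a i).2 < L) (f : Fin N → ℤ → ℂ) :
    descendMatrix p (pointWeight g a) L f a =
      (1 - g • transitionMatrix p c r a a)⁻¹ * descendMatrix p 1 L f a := by
  have hunit : IsUnit (1 - g • transitionMatrix p c r a a).det :=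
    (det_one_sub_smul_transitionMatrix p c r a g).symm ▸ isUnit_one
  have hB : descendMatrix p 1 L f a =
      (1 - g • transitionMatrix p c r a a) * descendMatrix p (pointWeight g a) L f a := by
    rw [Matrix.sub_mul, Matrix.one_mul, Matrix.smul_mul, eq_sub_iff_add_eq]
    exact (h.descendMatrix_pointWeight hp0 hp1 g ha f fun i => ⟨(ha i).1, (ha i).2.le⟩).symm
  rw [hB, nonsing_inv_mul_cancel_left _ _ hunit]

theorem IsOuterContour.tendsto_descendMatrix (h : IsOuterContour p c r) (hp0 : 0 < p)
    (hp1 : p < 1) {b : ι → ℕ × ℤ} (hb : ∀ i, (b i).1 ≤ N ∧ x ≤ (b i).2) :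
    Tendsto (fun l : ℕ =>
        descendMatrix p 1 (x + l) (fun j : Fin N => psi p N x c r (N - 1 - j)) b)
      atTop (𝓝 (psiMatrix p N x c r b)) := by
  refine tendsto_pi_nhds.2 fun i => tendsto_pi_nhds.2 fun j => ?_
  have hindex : (N : ℤ) - 1 - j - (N - (b i).1 : ℕ) = (b i).1 - 1 - j := by
    have := (hb i).1
    omega
  simpa only [descendMatrix, psiMatrix, of_apply, hindex] using
    h.tendsto_descend hp0 hp1 N (hb i).2 (N - 1 - j) (b i).1 (N - (b i).1)

end Matrices

section Correlations

open Finset Matrix Filter Topology Metric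

variable {p : ℝ} {c c₀ c₁ : ℂ} {r r₀ r₁ : ℝ} {N m : ℕ} {x : ℤ} {a : Fin m → ℕ × ℤ}

open scoped Classical in
theorem IsOuterContour.sum_truncated_phiWeight_mul_prod_ite_mul_det (h : IsOuterContour p c r)
    (hp0 : 0 ≤ p) (hp1 : p ≤ 1) (ha : Function.Injective a)
    (ha1 : ∀ b, 1 ≤ (a b).1 ∧ (a b).1 ≤ N) {L : ℤ} (hxL : x ≤ L) (haL : ∀ b, (a b).2 < L)
    (g : ℂ) (f : Fin N → ℤ → ℂ) :
    ∑ T ∈ truncated x L N, (phiWeight p T : ℂ) * (∏ b, if a b ∈ T.points then 1 + g else 1) *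
        (of fun i j => f j (T.top i)).det =
      (descendMatrix p 1 L f (floorPoint N x) + g • (transitionMatrix p c r (floorPoint N x) a *
        ((1 - g • transitionMatrix p c r a a)⁻¹ * descendMatrix p 1 L f a))).det := by
  simp only [← levelProd_pointWeight g ha fun b => (ha1 b).1]
  rw [sum_truncated_phiWeight_mul_det,
    ← h.descendMatrix_pointWeight_eq_inv_mul hp0 hp1 g (fun b => ⟨(ha1 b).2, haL b⟩),
    ← h.descendMatrix_pointWeight hp0 hp1 g (fun b => ⟨(ha1 b).2, haL b⟩) f
      fun i => ⟨i.is_le', hxL⟩]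
  rfl

open scoped Classical in
theorem summable_norm_weight_mul_prod_ite (hp0 : 0 < p) (hp1 : p < 1) (N : ℕ) (x : ℤ)
    (a : Fin m → ℕ × ℤ) (u v : ℂ) :
    Summable fun T : Config N x => ‖weight p T * ∏ b, if a b ∈ T.points then u else v‖ := by
  refine .of_nonneg_of_le (fun T => norm_nonneg _) (fun T => ?_)
    ((summable_norm_weight hp0 hp1 N x).mul_right (max ‖u‖ ‖v‖ ^ Fintype.card (Fin m)))
  rw [norm_mul]
  gcongr
  exact norm_prod_ite_le _ (le_max_left _ _) (le_max_right _ _)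

open scoped Classical in
theorem IsOuterContour.tsum_weight_mul_prod_ite (h : IsOuterContour p c r)
    (h₀ : IsOuterContour p c₀ r₀) (hp0 : 0 < p) (hp1 : p < 1) (ha : Function.Injective a)
    (ha' : ∀ b, 1 ≤ (a b).1 ∧ (a b).1 ≤ N ∧ x ≤ (a b).2) (g : ℂ) :
    ∑' T : Config N x, weight p T * ∏ b, (if a b ∈ T.points then 1 + g else 1) =
      (psiMatrix p N x c₀ r₀ (floorPoint N x) +
        g • (transitionMatrix p c r (floorPoint N x) a *
          ((1 - g • transitionMatrix p c r a a)⁻¹ * psiMatrix p N x c₀ r₀ a))).det := by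
  have hfloor := h₀.tendsto_descendMatrix (b := floorPoint N x) hp0 hp1
    fun i => ⟨i.is_le', le_rfl⟩
  have hpoints := h₀.tendsto_descendMatrix (x := x) hp0 hp1 fun b => (ha' b).2
  have hcont : Continuous fun Z : Matrix (Fin N) (Fin N) ℂ × Matrix (Fin m) (Fin N) ℂ =>
      (Z.1 + g • (transitionMatrix p c r (floorPoint N x) a *
        ((1 - g • transitionMatrix p c r a a)⁻¹ * Z.2))).det := by
    fun_prop
  have hsum := (summable_norm_weight_mul_prod_ite hp0 hp1 N x a (1 + g) 1).of_norm.hasSum.comp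
    (tendsto_truncated N x)
  refine tendsto_nhds_unique (hsum.congr' ?_) ((hcont.tendsto _).comp (hfloor.prodMk_nhds hpoints))
  have hL : ∀ᶠ l : ℕ in atTop, ∀ b, (a b).2 < x + l := eventually_all.2 fun b => by
    filter_upwards [eventually_gt_atTop ((a b).2 - x).toNat] with l hl
    omega
  filter_upwards [hL] with l hl
  refine Eq.trans (sum_congr rfl fun T _ => ?_)
    (h.sum_truncated_phiWeight_mul_prod_ite_mul_det hp0.le hp1.le ha
      (fun b => ⟨(ha' b).1, (ha' b).2.1⟩) (by omega) hl g _)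
  rw [h₀.weight_eq hp0 hp1]
  ring

theorem partitionFunction_eq_one (hp0 : 0 < p) (hp1 : p < 1) (N : ℕ) (x : ℤ) :
    partitionFunction p N x = 1 := by
  obtain ⟨c, r, h⟩ := exists_isOuterContour hp0 hp1
  simpa [h.det_psiMatrix_floorPoint, partitionFunction] using
    h.tsum_weight_mul_prod_ite (N := N) (x := x) h hp0 hp1
      (Function.injective_of_subsingleton Fin.elim0) (fun b => b.elim0) 0

open scoped Classical in
theorem IsOuterContour.tsum_weight_mul_prod_ite_eq_det_kernel (h : IsOuterContour p c r)
    (h₀ : IsOuterContour p c₀ r₀) (h₁ : IsInnerContour p c₁ r₁)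
    (hsub : closedBall c₁ r₁ ⊆ ball c₀ r₀) (hp0 : 0 < p) (hp1 : p < 1)
    (ha : Function.Injective a) (ha' : ∀ b, 1 ≤ (a b).1 ∧ (a b).1 ≤ N ∧ x ≤ (a b).2) (g : ℂ) :
    ∑' T : Config N x, weight p T * ∏ b, (if a b ∈ T.points then 1 + g else 1) =
      (1 + g • of fun i j => kernel p N x c₁ r₁ c₀ r₀ c r (a i) (a j)).det := by
  rw [h.tsum_weight_mul_prod_ite h₀ hp0 hp1 ha ha',
    ← h.psiMatrix_floorPoint_mul_dualPsiMatrix h₀ h₁ hsub fun b => (ha' b).2,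
    h₀.kernel_matrix_eq h₁ hsub x c r fun b => (ha' b).2.1, ← Matrix.smul_mul, ← Matrix.mul_smul,
    det_add_mul_inv_mul (det_one_sub_smul_transitionMatrix p c r a g),
    h₀.det_psiMatrix_floorPoint, one_mul, Matrix.mul_smul, smul_sub]
  congr 1
  abel

open scoped Classical in
theorem IsOuterContour.tsum_weight_mul_prod_ite_add_one (h : IsOuterContour p c r)
    (h₀ : IsOuterContour p c₀ r₀) (h₁ : IsInnerContour p c₁ r₁)
    (hsub : closedBall c₁ r₁ ⊆ ball c₀ r₀) (hp0 : 0 < p) (hp1 : p < 1)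
    (ha : Function.Injective a) (ha' : ∀ b, 1 ≤ (a b).1 ∧ (a b).1 ≤ N ∧ x ≤ (a b).2) {ε : ℂ}
    (hε : ε ≠ 0) :
    ∑' T : Config N x, weight p T * ∏ b, (if a b ∈ T.points then ε + 1 else ε) =
      (ε • 1 + of fun i j => kernel p N x c₁ r₁ c₀ r₀ c r (a i) (a j)).det := by
  have hscale (T : Config N x) : weight p T * ∏ b, (if a b ∈ T.points then ε + 1 else ε) =
      ε ^ m * (weight p T * ∏ b, (if a b ∈ T.points then 1 + ε⁻¹ else 1)) := by
    rw [mul_left_comm, ← Fin.prod_const, ← prod_mul_distrib]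
    simp only [mul_ite, mul_add, mul_one, mul_inv_cancel₀ hε]
  rw [tsum_congr hscale, tsum_mul_left,
    h.tsum_weight_mul_prod_ite_eq_det_kernel h₀ h₁ hsub hp0 hp1 ha ha']
  nth_rewrite 1 [← Fintype.card_fin m]
  rw [← det_smul, smul_add, smul_inv_smul₀ hε]

open scoped Classical in
theorem weight_mul_prod_ite_eq_indicator (p : ℝ) (a : Fin m → ℕ × ℤ) (T : Config N x) :
    weight p T * ∏ b, (if a b ∈ T.points then 1 else 0) =
      {T : Config N x | ∀ b, a b ∈ T.points}.indicator (weight p) T := by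
  simp [Finset.prod_ite_zero, Set.indicator_apply]

/-- The generating function is a polynomial in `g`, and the sum over the configurations containing
all the points `a b` is its coefficient of degree `m`; the limit `ε → 0` with `g = ε⁻¹` extracts
it. -/
theorem IsOuterContour.tsum_indicator_weight (h : IsOuterContour p c r)
    (h₀ : IsOuterContour p c₀ r₀) (h₁ : IsInnerContour p c₁ r₁)
    (hsub : closedBall c₁ r₁ ⊆ ball c₀ r₀) (hp0 : 0 < p) (hp1 : p < 1)
    (ha : Function.Injective a) (ha' : ∀ b, 1 ≤ (a b).1 ∧ (a b).1 ≤ N ∧ x ≤ (a b).2) :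
    ∑' T : Config N x, {T : Config N x | ∀ b, a b ∈ T.points}.indicator (weight p) T =
      (of fun i j => kernel p N x c₁ r₁ c₀ r₀ c r (a i) (a j)).det := by
  classical
  set K : Matrix (Fin m) (Fin m) ℂ := of fun i j => kernel p N x c₁ r₁ c₀ r₀ c r (a i) (a j)
  have hdet : Tendsto (fun ε : ℂ => (ε • 1 + K).det) (𝓝[≠] 0) (𝓝 K.det) := by
    have hcont : Continuous fun ε : ℂ => (ε • (1 : Matrix (Fin m) (Fin m) ℂ) + K).det := by fun_prop
    simpa using (hcont.tendsto 0).mono_left nhdsWithin_le_nhds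
  have hsum : Tendsto
      (fun ε : ℂ => ∑' T : Config N x, weight p T * ∏ b, if a b ∈ T.points then ε + 1 else ε)
      (𝓝[≠] 0) (𝓝 (∑' T : Config N x, {T | ∀ b, a b ∈ T.points}.indicator (weight p) T)) := by
    refine tendsto_tsum_of_dominated_convergence
      ((summable_norm_weight hp0 hp1 N x).mul_right (2 ^ Fintype.card (Fin m))) (fun T => ?_) ?_
    · have hcont : Continuous fun ε : ℂ =>
          weight p T * ∏ b, if a b ∈ T.points then ε + 1 else ε := by
        refine continuous_const.mul (continuous_finsetProd _ fun b _ => ?_)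
        split_ifs <;> fun_prop
      rw [← weight_mul_prod_ite_eq_indicator]
      simpa using (hcont.tendsto 0).mono_left nhdsWithin_le_nhds
    · filter_upwards [nhdsWithin_le_nhds (ball_mem_nhds 0 one_pos)] with ε hε T
      have hε1 : ‖ε‖ ≤ 1 := (mem_ball_zero_iff.1 hε).le
      rw [norm_mul]
      gcongr
      exact norm_prod_ite_le _ ((norm_add_le _ _).trans (by rw [norm_one]; linarith))
        (by linarith)
  refine tendsto_nhds_unique (hsum.congr' ?_) hdet
  filter_upwards [self_mem_nhdsWithin] with ε hε
  exact h.tsum_weight_mul_prod_ite_add_one h₀ h₁ hsub hp0 hp1 ha ha' hε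

end Correlations

section Measure

open Metric MeasureTheory

variable {p : ℝ} {N : ℕ} {x : ℤ}

theorem withDensityᵥ_count_apply {α E : Type*} [MeasurableSpace α] [MeasurableSingletonClass α]
    [NormedAddCommGroup E] [NormedSpace ℝ E] [CompleteSpace E] {f : α → E}
    (hf : Summable fun a => ‖f a‖) {s : Set α} (hs : MeasurableSet s) :
    (Measure.count.withDensityᵥ f) s = ∑' a, s.indicator f a := by
  have hint : Integrable f Measure.count := integrable_count_iff.2 hf
  rw [withDensityᵥ_apply hint hs, ← integral_indicator hs]
  have hsum := (hasSum_integral_measure (hint.indicator hs)).tsum_eq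
  simp only [integral_dirac] at hsum
  exact hsum.symm

/-- The signed measure with point masses `weight p T`, which are real. -/
noncomputable def weightMeasure (p : ℝ) (N : ℕ) (x : ℤ) : SignedMeasure (Config N x) :=
  Measure.count.withDensityᵥ fun T => (weight p T).re

instance : MeasurableSingletonClass (Config N x) :=
  ⟨fun _ => trivial⟩

theorem weightMeasure_apply (hp0 : 0 < p) (hp1 : p < 1) (s : Set (Config N x)) :
    (weightMeasure p N x s : ℂ) = ∑' T, s.indicator (weight p) T := by
  have hre : Summable fun T : Config N x => ‖(weight p T).re‖ :=
    .of_nonneg_of_le (fun T => norm_nonneg _) (fun T => Complex.abs_re_le_norm _)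
      (summable_norm_weight hp0 hp1 N x)
  rw [weightMeasure, withDensityᵥ_count_apply hre trivial, Complex.ofReal_tsum]
  refine tsum_congr fun T => ?_
  by_cases hT : T ∈ s
  · simp only [Set.indicator_of_mem hT]
    exact Complex.ext rfl (weight_im p T).symm
  · simp only [Set.indicator_of_notMem hT, Complex.ofReal_zero]

theorem weightMeasure_singleton (hp0 : 0 < p) (hp1 : p < 1) (T : Config N x) :
    (weightMeasure p N x {T} : ℂ) = weight p T := by
  rw [weightMeasure_apply hp0 hp1, ← tsum_subtype, tsum_singleton]

theorem isCorrelationKernel_weightMeasure {c₁ c₀ c : ℂ} {r₁ r₀ r : ℝ} (hp0 : 0 < p) (hp1 : p < 1)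
    (h₁ : IsInnerContour p c₁ r₁) (h₀ : IsOuterContour p c₀ r₀) (h : IsOuterContour p c r)
    (hsub : closedBall c₁ r₁ ⊆ ball c₀ r₀) :
    IsCorrelationKernel (weightMeasure p N x) (kernel p N x c₁ r₁ c₀ r₀ c r) := fun m a ha ha' => by
  rw [weightMeasure_apply hp0 hp1, h.tsum_indicator_weight h₀ h₁ hsub hp0 hp1 ha ha']

end Measure

end TasepKernel

open TasepKernel in
theorem mainTheorem5 (p : ℝ) (hp0 : 0 < p) (hp1 : p < 1) (N : ℕ) (x : ℤ) :
    Summable (fun T : Config N x => weight p T) ∧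
    partitionFunction p N x ≠ 0 ∧
    ∃ M : MeasureTheory.SignedMeasure (Config N x),
      (∀ T : Config N x, ((M {T} : ℝ) : ℂ) = (partitionFunction p N x)⁻¹ * weight p T) ∧
      ∀ (c₁ : ℂ) (r₁ : ℝ) (c₀ : ℂ) (r₀ : ℝ) (c : ℂ) (r : ℝ),
        -- the contour of `v` encircles `1` but neither `0` nor `-p/q`
        1 ∈ Metric.ball c₁ r₁ →
        0 ∉ Metric.closedBall c₁ r₁ →
        (-(p / (1 - p)) : ℂ) ∉ Metric.closedBall c₁ r₁ →
        -- the contour of `w` encircles `0` and the contour of `v`, but not `-p/q`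
        0 ∈ Metric.ball c₀ r₀ →
        Metric.closedBall c₁ r₁ ⊆ Metric.ball c₀ r₀ →
        (-(p / (1 - p)) : ℂ) ∉ Metric.closedBall c₀ r₀ →
        -- the contour of `z` encircles `0` and `1`, but not `-p/q`
        0 ∈ Metric.ball c r →
        1 ∈ Metric.ball c r →
        (-(p / (1 - p)) : ℂ) ∉ Metric.closedBall c r →
        IsCorrelationKernel M (kernel p N x c₁ r₁ c₀ r₀ c r) := by
  have hZ : partitionFunction p N x = 1 := partitionFunction_eq_one hp0 hp1 N x
  refine ⟨(summable_norm_weight hp0 hp1 N x).of_norm, hZ ▸ one_ne_zero, weightMeasure p N x,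
    fun T => ?_, ?_⟩
  · rw [weightMeasure_singleton hp0 hp1, hZ, inv_one, one_mul]
  · intro c₁ r₁ c₀ r₀ c r h1 h0 hP h0' hsub hP' hc0 hc1 hcP
    have h1' : 1 ∈ Metric.ball c₀ r₀ := hsub (Metric.ball_subset_closedBall h1)
    exact isCorrelationKernel_weightMeasure hp0 hp1 ⟨.of_notMem hp1 h1 hP, h0⟩
      ⟨.of_notMem hp1 h1' hP', h0'⟩ ⟨.of_notMem hp1 hc1 hcP, hc0⟩ hsub
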